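/- **Setting.** Let $Q$ be a finite quiver with vertex set $\mathcal I$, edge set $\mathcal E$, head and tail maps $h,t:\mathcal E\to\mathcal I$, no edge loops, and a distinguished vertex $\infty$. Let $\tilde Q$ be the doubled quiver with edges $\mathcal E\cup\bar{\mathcal E}$, where $\bar a$ is $a$ reversed. For $v\in\mathbb Z_{\ge0}^{\mathcal I}$ with $v_\infty=1$ put $V_i=\mathbb C^{v_i}$ with its standard Hermitian structure, $\mathrm{Rep}(\tilde Q,v)=\bigoplus_{a}\mathrm{Hom}(V_{t(a)},V_{h(a)})$, $G_v=\prod_i GL(V_i)$, and let $\mu_I(A,B)=\frac1{2i}\sum_{a\in\mathcal E}\big([A_a,A_a^*]+[B_{\bar a},B_{\bar a}^*]\big)$, $\mu_{\mathbb C}(A,B)=\sum_{a\in\mathcal E}[A_a,B_{\bar a}]$. Let $\alpha(Q,v)$ be the stability parameter $\alpha_\infty=-\sum_{j\ne\infty}v_j$, $\alpha_i=1$ for $i\neq\infty$ (also regarded as the central element $(i\alpha_j\,\mathrm{id}_{V_j})_j$). Let $\mathcal M(Q,v)=\mu_{\mathbb C}^{-1}(0)^{\alpha\text{-st}}/G_v$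 be the quotient of the $\alpha(Q,v)$-stable points (GIT stability for the lift of the action to $\mathrm{Rep}(\tilde Q,v)\times\mathbb C$ by the character $\prod_i\det(g_i)^{\alpha_i}$), with the quotient topology. For a vertex $k\ne\infty$ and $r\ge0$, let $\mathcal M_{k;r}(Q,v)\subset\mathcal M(Q,v)$ be the set of classes $[x]$ such that $\sum_{h(a)=k}\mathrm{im}\,x_a$ (sum over the edges of $\tilde Q$) has codimension $r$ in $V_k$. *Nakajima's projection* $p:\mathcal M_{k;r}(Q,v)\to\mathcal M_{k;0}(Q,v-re_k)$ is defined as follows: fix $V_k'\subset V_k$ of codimension $r$, choose a representative $x$ of the class with $\sum_{h(a)=k}\mathrm{im}\,x_a\subset V_k'$, and let $p([x])$ be the class of the restriction of $x$ to the spaces $V_k'$ and $V_i$ $(i\ne k)$. *Approximate flow lines.* Let $v_1\le v$ with $(v_1)_\infty=1$, and fix the standard inclusions $\mathbb C^{(v_1)_i}\subset\mathbb C^{v_i}$. Write $(x_1,0)$ for the extension by zero of $x_1\in\mathrm{Rep}(\tilde Q,v_1)$. For a critical point $x\in\mu_{\mathbb C}^{-1}(0)$ of $f=\|\mu_I-\alpha(Q,v)\|^2$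 on $\mathrm{Rep}(\tilde Q,v)$ let $S_x^-$ be the set of those $\delta x$ in the sum of the negative eigenspaces of the Hessian of $f$ at $x$ that are orthogonal to the tangent space of the orbit $G_v\cdot x$ and satisfy $\mu_{\mathbb C}(x+\delta x)=0$. Then $\mathcal{MF}(Q,v_1,v)\subset\mathcal M(Q,v_1)\times\mathcal M(Q,v)$ is the set of pairs of classes that have representatives $x_1$, $x_2$ such that $(x_1,0)$ and $x_2$ are critical points of $f$ and $(x_1,0)+\delta x\in G_v\cdot x_2$ for some $\delta x\in S_{(x_1,0)}^-$. **Proposition.** The map $p:\mathcal M_{k;r}(Q,v)\to\mathcal M_{k;0}(Q,v-re_k)$ is well defined. For every $[x]\in\mathcal M_{k;r}(Q,v)$ there is a unique $[x_0]\in\mathcal M_{k;0}(Q,v-re_k)$ such that $([x_0],[x])\in\mathcal{MF}(Q,v-re_k,v)$, and $[x_0]=p([x])$. Consequently the restriction of the flow-line projection recovers Nakajima's projection $p$ (the bundle map of Nakajima's Grassmann bundle): the second projection maps $$\big(\mathcal M_{k;0}(Q,v-re_k)\times\mathcal M_{k;r}(Q,v)\big)\cap\mathcal{MF}(Q,v-re_k,v)$$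 homeomorphically onto $\mathcal M_{k;r}(Q,v)$, and under this homeomorphism the first projection becomes $p$. -/

import Mathlib

open scoped Matrix

noncomputable section

namespace NakajimaFlow

universe u w

/-! ### Quivers and their representations -/

/-- A quiver with vertices `I`, edges `E` and head/tail maps. -/
structure Quiv (I : Type u) (E : Type w) where
  head : E → I
  tail : E → I

/-- The quiver `Q̃` with the same vertices and with edges `E ∪ Ē`: the edge `inl a` is `a`,
and the edge `inr a` is `a` with the opposite orientation. -/
def Quiv.double {I : Type u} {E : Type w} (Q : Quiv I E) : Quiv I (E ⊕ E) where
  head := Sum.elim Q.head Q.tail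
  tail := Sum.elim Q.tail Q.head

/-- The space `Rep(Q, v)`, with `V_i = ℂ^{v_i}` carrying its standard Hermitian structure. -/
abbrev Rep {I : Type u} {E : Type w} (Q : Quiv I E) (v : I → ℕ) : Type w :=
  ∀ a : E, Matrix (Fin (v (Q.head a))) (Fin (v (Q.tail a))) ℂ

/-- The group `G_v = ∏ GL(V_i)`. -/
abbrev Gauge {I : Type u} (v : I → ℕ) : Type u := ∀ i, GL (Fin (v i)) ℂ

/-- The Lie algebra `𝔤_v = ⨁ End(V_i)`. -/
abbrev GaugeLie {I : Type u} (v : I → ℕ) : Type u := ∀ i, Matrix (Fin (v i)) (Fin (v i)) ℂ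

section General

variable {I : Type u} {E : Type w} {Q : Quiv I E} {v : I → ℕ}

/-- The action `(g · A)_a = g_{h(a)} A_a g_{t(a)}⁻¹` of `G_v` on `Rep(Q, v)`. -/
def act (g : Gauge v) (A : Rep Q v) : Rep Q v := fun a =>
  (g (Q.head a) : Matrix (Fin (v (Q.head a))) (Fin (v (Q.head a))) ℂ) * A a *
    (((g (Q.tail a))⁻¹ : GL (Fin (v (Q.tail a))) ℂ) :
      Matrix (Fin (v (Q.tail a))) (Fin (v (Q.tail a))) ℂ)

theorem act_one (A : Rep Q v) : act 1 A = A := by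
  funext a; simp [act]

theorem act_mul (g h : Gauge v) (A : Rep Q v) : act (g * h) A = act g (act h A) := by
  funext a; simp [act, mul_inv_rev, Matrix.mul_assoc]

/-- Isomorphism of representations: being in the same `G_v`-orbit. -/
def orbitSetoid (Q : Quiv I E) (v : I → ℕ) : Setoid (Rep Q v) where
  r A B := ∃ g : Gauge v, act g A = B
  iseqv :=
    { refl := fun A => ⟨1, act_one A⟩
      symm := by
        rintro A B ⟨g, rfl⟩
        exact ⟨g⁻¹, by rw [← act_mul, inv_mul_cancel, act_one]⟩
      trans := by
        rintro A B C ⟨g, rfl⟩ ⟨h, rfl⟩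
        exact ⟨h * g, act_mul h g A⟩ }

/-- The space of `G_v`-orbits in `Rep(Q, v)`, with the quotient topology. -/
abbrev Orbits (Q : Quiv I E) (v : I → ℕ) : Type w := Quotient (orbitSetoid Q v)

/-- The orbit `[A]`. -/
def toOrbit (A : Rep Q v) : Orbits Q v := Quotient.mk (orbitSetoid Q v) A

/-- The infinitesimal action `ρ_A(u) = (u_{h(a)} A_a - A_a u_{t(a)})_a` of `𝔤_v`. -/
def infAct (A : Rep Q v) (u : GaugeLie v) : Rep Q v := fun a =>
  u (Q.head a) * A a - A a * u (Q.tail a)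

/-! ### Stability (geometric invariant theory) -/

/-- The character `χ_α(g) = ∏ (det g_i)^{α_i}` of `G_v`. -/
def character [Fintype I] (α : I → ℤ) (g : Gauge v) : ℂ :=
  ∏ i, (g i : Matrix (Fin (v i)) (Fin (v i)) ℂ).det ^ α i

/-- The orbit of `(A, ξ)` in the trivial line bundle `Rep(Q, v) × ℂ` for the action lifted
by `χ_α`. -/
def liftedOrbit [Fintype I] (α : I → ℤ) (A : Rep Q v) (ξ : ℂ) : Set (Rep Q v × ℂ) :=
  Set.range fun g : Gauge v => (act g A, character α g * ξ)

def IsSemistable [Fintype I] (α : I → ℤ) (A : Rep Q v) : Prop :=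
  ∀ ξ : ℂ, ξ ≠ 0 → closure (liftedOrbit α A ξ) ∩ {p | p.2 = 0} = ∅

def IsPolystable [Fintype I] (α : I → ℤ) (A : Rep Q v) : Prop :=
  IsSemistable α A ∧ ∀ ξ : ℂ, ξ ≠ 0 → IsClosed (liftedOrbit α A ξ)

/-- `A` is stable if it is polystable and its isotropy group consists of scalars. -/
def IsStable [Fintype I] (α : I → ℤ) (A : Rep Q v) : Prop :=
  IsPolystable α A ∧
    ∀ g : Gauge v, act g A = A →
      ∃ c : ℂ, ∀ i, (g i : Matrix (Fin (v i)) (Fin (v i)) ℂ) = c • 1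

/-- The canonical stability parameter: `-∑_{j ≠ ∞} v_j` at the vertex `∞ = o`, and `1` at all
other vertices. -/
def canonicalParam [Fintype I] [DecidableEq I] (o : I) (v : I → ℕ) : I → ℤ := fun i =>
  if i = o then -∑ j ∈ Finset.univ.erase o, (v j : ℤ) else 1

/-! ### Moment maps -/

/-- Index set of the standard basis of `Vect(Q, v) = ⨁ V_i`. -/
abbrev VectIdx {I : Type u} (v : I → ℕ) : Type u := Σ i, Fin (v i)

/-- A homomorphism `V_j → V_i`, considered as an endomorphism of `Vect(Q, v)`. -/
def toEnd [DecidableEq I] {i j : I} (M : Matrix (Fin (v i)) (Fin (v j)) ℂ) :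
    Matrix (VectIdx v) (VectIdx v) ℂ := fun p q =>
  if h : p.1 = i ∧ q.1 = j then
    M (Fin.cast (congrArg v h.1) p.2) (Fin.cast (congrArg v h.2) q.2) else 0

/-- The commutator of endomorphisms of `Vect(Q, v)`. -/
def comm [Fintype I] (M N : Matrix (VectIdx v) (VectIdx v) ℂ) :
    Matrix (VectIdx v) (VectIdx v) ℂ := M * N - N * M

/-- The moment map `μ(A) = (1 / 2i) ∑_a [A_a, A_a^*]` for the action of `K_v = ∏ U(V_i)`.
On the doubled quiver this is the moment map `μ_I(A, B)`. -/
def momentMap [Fintype I] [DecidableEq I] [Fintype E] (A : Rep Q v) :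
    Matrix (VectIdx v) (VectIdx v) ℂ :=
  (1 / (2 * Complex.I)) • ∑ a, comm (toEnd (A a)) (toEnd (A a))ᴴ

/-- The central element `(i α_j · id_{V_j})_j` determined by a stability parameter. -/
def centralElement [DecidableEq I] (v : I → ℕ) (α : I → ℤ) :
    Matrix (VectIdx v) (VectIdx v) ℂ :=
  Matrix.diagonal fun p => Complex.I * (α p.1 : ℂ)

/-- The complex moment map `μ_ℂ(A, B) = ∑_a [A_a, B_ā]` on `Rep(Q̃, v) = T^* Rep(Q, v)`. -/
def complexMomentMap [Fintype I] [DecidableEq I] [Fintype E] (x : Rep Q.double v) :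
    Matrix (VectIdx v) (VectIdx v) ℂ :=
  ∑ a : E, comm (toEnd (i := Q.head a) (j := Q.tail a) (x (Sum.inl a)))
    (toEnd (i := Q.tail a) (j := Q.head a) (x (Sum.inr a)))

/-- The metric `g(X, Y) = ∑_a Re Tr(X_a Y_a^*)`. -/
def metric [Fintype E] (X Y : Rep Q v) : ℝ := ∑ a, ((X a * (Y a)ᴴ).trace).re

/-- The function `‖μ - α‖²`. -/
def energy [Fintype I] [DecidableEq I] [Fintype E] (α : I → ℤ) (A : Rep Q v) : ℝ :=
  ∑ p, ∑ q, ‖(momentMap A - centralElement v α) p q‖ ^ 2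

/-- `A` is a critical point of `‖μ - α‖²`: all directional derivatives vanish (the function
is a real polynomial on a finite-dimensional space). -/
def IsCritical [Fintype I] [DecidableEq I] [Fintype E] (α : I → ℤ) (A : Rep Q v) : Prop :=
  ∀ X : Rep Q v, HasDerivAt (fun t : ℝ => energy α (A + t • X)) 0 0

/-- The Hessian of `‖μ - α‖²` at `A`, as a bilinear form. -/
def hessian [Fintype I] [DecidableEq I] [Fintype E] (α : I → ℤ) (A X Y : Rep Q v) : ℝ :=
  deriv (fun s : ℝ => deriv (fun t : ℝ => energy α (A + s • X + t • Y)) 0) 0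

/-- The negative eigenspace `⨁_{l < 0} V_l` of the Hessian; here `V_l` consists of the `X`
with `H X = l X`, where `H` is the operator that represents the Hessian in the metric. -/
def negSpace [Fintype I] [DecidableEq I] [Fintype E] (α : I → ℤ) (A : Rep Q v) :
    Submodule ℝ (Rep Q v) :=
  ⨆ l : Set.Iio (0 : ℝ), Submodule.span ℝ
    {X : Rep Q v | ∀ Y, hessian α A X Y = (l : ℝ) * metric X Y}

/-! ### Sub-dimension-vectors -/

/-- The representation `(x₁, 0)` of dimension `v`, obtained from `x₁` of dimension `v₁ ≤ v`
through the inclusions `ℂ^{v₁ i} ⊆ ℂ^{v i}` of the first coordinates. -/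
def extend {v₁ v : I → ℕ} (x₁ : Rep Q v₁) : Rep Q v := fun a p q =>
  if h : (p : ℕ) < v₁ (Q.head a) ∧ (q : ℕ) < v₁ (Q.tail a) then
    x₁ a ⟨p, h.1⟩ ⟨q, h.2⟩ else 0

/-- The restriction of a representation of dimension `v` to `⨁ ℂ^{v₁ i} ⊆ ⨁ ℂ^{v i}` (where
this subspace is invariant; in general, the compression to it). -/
def restrict {v₁ v : I → ℕ} (h : v₁ ≤ v) (x : Rep Q v) : Rep Q v₁ := fun a =>
  (x a).submatrix (Fin.castLE (h (Q.head a))) (Fin.castLE (h (Q.tail a)))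

/-- The subspace `∑_{h(a) = k} im x_a` of `V_k`. -/
def imageAt (k : I) (x : Rep Q v) : Submodule ℂ (Fin (v k) → ℂ) :=
  ⨆ (a : E) (h : Q.head a = k),
    (LinearMap.range (x a).mulVecLin).map
      (LinearMap.funLeft ℂ ℂ (Fin.cast (congrArg v h.symm)))

end General

/-! ### Nakajima quiver varieties and approximate flow lines -/

section Nakajima

variable {I : Type u} {E : Type w} [Fintype I] [DecidableEq I] [Fintype E]

/-- The quiver variety `𝓜(Q, v) = μ_ℂ⁻¹(0)^{α-st} / G_v` for the canonical stability parameter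
`α = α(Q, v)`, as a subspace of the orbit space of `Rep(Q̃, v)`. -/
def quiverVariety (Q : Quiv I E) (o : I) (v : I → ℕ) : Set (Orbits Q.double v) :=
  {c | ∃ x : Rep Q.double v, toOrbit x = c ∧ complexMomentMap x = 0 ∧
    IsStable (canonicalParam o v) x}

/-- The subset `𝓜_{k;r}(Q, v)` of the classes `[x]` such that `∑_{h(a) = k} im x_a` has
codimension `r` in `V_k`; the edges `a` are those of the doubled quiver. -/
def quiverStratum (Q : Quiv I E) (o : I) (v : I → ℕ) (k : I) (r : ℕ) :
    Set (Orbits Q.double v) :=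
  {c | c ∈ quiverVariety Q o v ∧ ∃ x : Rep Q.double v, toOrbit x = c ∧
    Module.finrank ℂ ((Fin (v k) → ℂ) ⧸ imageAt k x) = r}

/-- The set `C_{v₁}^0` of critical points `(x₁, 0)` of `‖μ_I - α(Q, v)‖²` on `μ_ℂ⁻¹(0)` in
`Rep(Q̃, v)` whose stable summand containing the vertex `∞` is `x₁`, of dimension `v₁`. (The
stability parameter induced by `α(Q, v)` on dimension `v₁` is a positive multiple of
`α(Q, v₁)`.) -/
def criticalSet (Q : Quiv I E) (o : I) (v₁ v : I → ℕ) : Set (Rep Q.double v) :=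
  {x | complexMomentMap x = 0 ∧ IsCritical (canonicalParam o v) x ∧
    ∃ x₁ : Rep Q.double v₁, x = extend x₁ ∧ IsStable (canonicalParam o v₁) x₁}

/-- The slice `S_x`: the `δx` in `ker (ρ_x^ℂ)^* = (im ρ_x^ℂ)^⊥` with `x + δx ∈ μ_ℂ⁻¹(0)`. -/
def slice {Q : Quiv I E} {v : I → ℕ} (x : Rep Q.double v) : Set (Rep Q.double v) :=
  {δ | (∀ u : GaugeLie v, metric (infAct x u) δ = 0) ∧ complexMomentMap (x + δ) = 0}

/-- The negative slice `S_x^-`, for the stability parameter `α(Q, v)`. -/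
def negSlice {Q : Quiv I E} (o : I) {v : I → ℕ} (x : Rep Q.double v) : Set (Rep Q.double v) :=
  {δ | δ ∈ negSpace (canonicalParam o v) x} ∩ slice x

/-- The space `𝓒(Q, v₁, v₂, v)` of pairs of critical points in `C_{v₁}^0 × C_{v₂}^0` that are
connected by an approximate flow line, for `v₁ ≤ v₂ ≤ v`. -/
def approxFlowPairs (Q : Quiv I E) (o : I) (v₁ v₂ v : I → ℕ) :
    Set (Rep Q.double v × Rep Q.double v) :=
  {z | z.1 ∈ criticalSet Q o v₁ v ∧ z.2 ∈ criticalSet Q o v₂ v ∧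
    ∃ δ ∈ negSlice o z.1, toOrbit (z.1 + δ) = toOrbit z.2}

/-- The space `𝓜𝓕(Q, v₁, v₂) ⊆ 𝓜(Q, v₁) × 𝓜(Q, v₂)` of pairs of classes connected by an
approximate flow line. -/
def flowModuli (Q : Quiv I E) (o : I) (v₁ v₂ : I → ℕ) :
    Set (Orbits Q.double v₁ × Orbits Q.double v₂) :=
  {c | c.1 ∈ quiverVariety Q o v₁ ∧ c.2 ∈ quiverVariety Q o v₂ ∧
    ∃ (x₁ : Rep Q.double v₁) (x₂ : Rep Q.double v₂), toOrbit x₁ = c.1 ∧ toOrbit x₂ = c.2 ∧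
      (extend x₁, x₂) ∈ approxFlowPairs Q o v₁ v₂ v₂}

/-! ### Nakajima's projection -/

/-- The dimension vector `v - r e_k`. -/
def lower {I : Type u} [DecidableEq I] (v : I → ℕ) (k : I) (r : ℕ) : I → ℕ := v - Pi.single k r

theorem lower_le {I : Type u} [DecidableEq I] (v : I → ℕ) (k : I) (r : ℕ) : lower v k r ≤ v := tsub_le_self

/-- `∑_{h(a) = k} im x_a ⊆ V_k'`, where `V_k' ⊆ V_k` is the span of the first `v_k - r`
coordinate vectors. -/
def IsAdapted {Q : Quiv I E} {v : I → ℕ} (k : I) (r : ℕ) (x : Rep Q.double v) : Prop :=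
  ∀ y ∈ imageAt k x, ∀ j : Fin (v k), v k - r ≤ (j : ℕ) → y j = 0

open Classical in
/-- Nakajima's projection `p : 𝓜_{k;r}(Q, v) → 𝓜_{k;0}(Q, v - r e_k)`: choose a representative
`x` of the class with `∑_{h(a) = k} im x_a ⊆ V_k'` and restrict it to dimension `v - r e_k`.
(The value at a class without such a representative is of no importance.) -/
def nakajimaProj {Q : Quiv I E} {v : I → ℕ} (k : I) (r : ℕ) (c : Orbits Q.double v) :
    Orbits Q.double (lower v k r) :=
  if h : ∃ x : Rep Q.double v, toOrbit x = c ∧ IsAdapted k r x then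
    toOrbit (restrict (lower_le v k r) h.choose)
  else toOrbit 0

/-- The part of `𝓜𝓕(Q, v - r e_k, v)` that lies in `𝓜_{k;0}(Q, v - r e_k) × 𝓜_{k;r}(Q, v)`. -/
def restrictedFlow (Q : Quiv I E) (o : I) (v : I → ℕ) (k : I) (r : ℕ) :
    Set (Orbits Q.double (lower v k r) × Orbits Q.double v) :=
  (quiverStratum Q o (lower v k r) k 0 ×ˢ quiverStratum Q o v k r) ∩
    flowModuli Q o (lower v k r) v

end Nakajima

end NakajimaFlow

end

/-!
For the canonical parameter a representation is stable if and only if it has no nonzero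
subrepresentation vanishing at `∞`, and by the Kempf–Ness theorem its orbit then contains a
critical point. At a critical point `(x₁, 0)` the Hermitian matrix `-i (μ_I - α)` is a nonnegative
scalar on `V₁` and `-1` on the complement `V₂`, so that the negative directions orthogonal to the
orbit lie in `⨁_a Hom(V₂, V₁)`. Flow lines from `(x₁, 0)` therefore lead exactly to the classes of
those stable `x` that map all of `V` into `V₁` and restrict to `x₁` on `V₁`. If `v₁ = v - r e_k` and
`∑_{h(a) = k} im x_a` has codimension `r`, this sum has to be `V₁` at the vertex `k`, which leaves
`[x₁] = p([x])` as the only possibility. The map `p` is continuous because a basis of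
`∑_{h(a) = k} im x_a` extends to a continuous family on the representations near `x`, and because
the quotient map onto the orbit space is open.
-/

noncomputable section

namespace NakajimaFlow

universe u w

section TraceForm

variable {ι : Type*} [Fintype ι] {m n : ι → Type*} [∀ i, Fintype (m i)] [∀ i, Fintype (n i)]

/-- The real inner product `∑ i, Re Tr(X_i Y_i^*)` on families of complex matrices. -/
def traceForm : LinearMap.BilinForm ℝ (∀ i, Matrix (m i) (n i) ℂ) :=
  LinearMap.mk₂ ℝ (fun X Y => ∑ i, ((X i * (Y i)ᴴ).trace).re)
    (fun X X' Y => by simp [Matrix.add_mul, Finset.sum_add_distrib])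
    (fun t X Y => by simp [Finset.mul_sum])
    (fun X Y Y' => by simp [Matrix.mul_add, Finset.sum_add_distrib])
    (fun t X Y => by simp [Finset.mul_sum])

theorem traceForm_apply (X Y : ∀ i, Matrix (m i) (n i) ℂ) :
    traceForm X Y = ∑ i, ((X i * (Y i)ᴴ).trace).re := rfl

theorem traceForm_comm (X Y : ∀ i, Matrix (m i) (n i) ℂ) : traceForm X Y = traceForm Y X := by
  refine Finset.sum_congr rfl fun i _ => ?_
  rw [← Complex.conj_re, ← Complex.star_def, ← Matrix.trace_conjTranspose,
    Matrix.conjTranspose_mul, Matrix.conjTranspose_conjTranspose]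

theorem traceForm_eq_sum_inner (X Y : ∀ i, Matrix (m i) (n i) ℂ) :
    traceForm X Y = ∑ i, ∑ p, ∑ q, inner ℝ (X i p q) (Y i p q) := by
  simp only [traceForm_apply, Matrix.trace, Matrix.diag_apply, Matrix.mul_apply,
    Matrix.conjTranspose_apply, Complex.re_sum, Complex.inner]
  refine Finset.sum_congr rfl fun i _ => Finset.sum_congr rfl fun p _ =>
    Finset.sum_congr rfl fun q _ => ?_
  simp [mul_comm]

theorem traceForm_self (X : ∀ i, Matrix (m i) (n i) ℂ) :
    traceForm X X = ∑ i, ∑ p, ∑ q, ‖X i p q‖ ^ 2 := by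
  simp only [traceForm_eq_sum_inner, real_inner_self_eq_norm_sq]

theorem traceForm_self_nonneg (X : ∀ i, Matrix (m i) (n i) ℂ) : 0 ≤ traceForm X X := by
  rw [traceForm_self]
  positivity

theorem norm_sq_le_traceForm_self (X : ∀ i, Matrix (m i) (n i) ℂ) (i : ι) (p : m i) (q : n i) :
    ‖X i p q‖ ^ 2 ≤ traceForm X X := by
  rw [traceForm_self]
  calc ‖X i p q‖ ^ 2 ≤ ∑ q, ‖X i p q‖ ^ 2 :=
        Finset.single_le_sum (f := fun q => ‖X i p q‖ ^ 2) (fun _ _ => by positivity)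
          (Finset.mem_univ q)
    _ ≤ ∑ p, ∑ q, ‖X i p q‖ ^ 2 :=
        Finset.single_le_sum (f := fun p => ∑ q, ‖X i p q‖ ^ 2) (fun _ _ => by positivity)
          (Finset.mem_univ p)
    _ ≤ ∑ i, ∑ p, ∑ q, ‖X i p q‖ ^ 2 :=
        Finset.single_le_sum (f := fun i => ∑ p, ∑ q, ‖X i p q‖ ^ 2) (fun _ _ => by positivity)
          (Finset.mem_univ i)

theorem eq_zero_of_traceForm_self {X : ∀ i, Matrix (m i) (n i) ℂ} (h : traceForm X X = 0) :
    X = 0 := by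
  ext i p q
  have := norm_sq_le_traceForm_self X i p q
  simpa [h] using this.antisymm (by rw [h]; positivity)

theorem isCompl_orthogonal_traceForm [∀ i, Finite (m i)] [∀ i, Finite (n i)]
    (W : Submodule ℝ (∀ i, Matrix (m i) (n i) ℂ)) :
    IsCompl W ((traceForm (m := m) (n := n)).orthogonal W) := by
  refine LinearMap.BilinForm.isCompl_orthogonal_of_restrict_nondegenerate
    (fun X Y h => (traceForm_comm Y X).trans h) ?_
  exact ⟨fun X hX => Subtype.ext (eq_zero_of_traceForm_self (hX X)),
    fun X hX => Subtype.ext (eq_zero_of_traceForm_self (hX X))⟩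

end TraceForm

section CommSum

variable {I : Type u} [DecidableEq I] {E : Type w} [Fintype E] {Q : Quiv I E} {v v' : I → ℕ}

/-- The diagonal blocks of `∑_a [A_a, B_a]`, where `A_a` runs along the edge `a` and `B_a` runs
in the opposite direction. -/
def commSum (A : Rep Q v) (B : ∀ a, Matrix (Fin (v (Q.tail a))) (Fin (v (Q.head a))) ℂ) :
    GaugeLie v :=
  ∑ a, (Pi.single (Q.head a) (A a * B a) - Pi.single (Q.tail a) (B a * A a))

theorem single_mul_mul (G : ∀ i, Matrix (Fin (v' i)) (Fin (v i)) ℂ)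
    (G' : ∀ i, Matrix (Fin (v i)) (Fin (v' i)) ℂ) {j : I}
    (M : Matrix (Fin (v j)) (Fin (v j)) ℂ) (i : I) :
    (Pi.single j (G j * M * G' j) : GaugeLie v') i =
      G i * (Pi.single j M : GaugeLie v) i * G' i :=
  (Pi.apply_single (fun i (N : Matrix (Fin (v i)) (Fin (v i)) ℂ) => G i * N * G' i)
    (fun i => by rw [Matrix.mul_zero, Matrix.zero_mul]) j M i).symm

theorem commSum_eq_mul_mul (G : ∀ i, Matrix (Fin (v' i)) (Fin (v i)) ℂ)
    (G' : ∀ i, Matrix (Fin (v i)) (Fin (v' i)) ℂ) {A : Rep Q v} {A' : Rep Q v'} {B B'}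
    (hA' : ∀ a, A' a = G (Q.head a) * A a * G' (Q.tail a))
    (hB' : ∀ a, B' a = G (Q.tail a) * B a * G' (Q.head a))
    (hA : ∀ a, G' (Q.head a) * G (Q.head a) * A a = A a)
    (hB : ∀ a, G' (Q.tail a) * G (Q.tail a) * B a = B a) (i : I) :
    commSum A' B' i = G i * commSum A B i * G' i := by
  have hAB : ∀ a, A' a * B' a = G (Q.head a) * (A a * B a) * G' (Q.head a) := fun a => by
    calc A' a * B' a = G (Q.head a) * A a * (G' (Q.tail a) * G (Q.tail a) * B a) * G' (Q.head a) :=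
          by simp only [hA', hB', Matrix.mul_assoc]
      _ = _ := by rw [hB, Matrix.mul_assoc (G _)]
  have hBA : ∀ a, B' a * A' a = G (Q.tail a) * (B a * A a) * G' (Q.tail a) := fun a => by
    calc B' a * A' a = G (Q.tail a) * B a * (G' (Q.head a) * G (Q.head a) * A a) * G' (Q.tail a) :=
          by simp only [hA', hB', Matrix.mul_assoc]
      _ = _ := by rw [hA, Matrix.mul_assoc (G _)]
  simp only [commSum, Finset.sum_apply, Pi.sub_apply, hAB, hBA, single_mul_mul, Matrix.mul_sum,
    Matrix.sum_mul, Matrix.mul_sub, Matrix.sub_mul]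

theorem sum_trace_mul_single [Fintype I] (u : GaugeLie v) {j : I}
    (M : Matrix (Fin (v j)) (Fin (v j)) ℂ) :
    ∑ i, (u i * (Pi.single j M : GaugeLie v) i).trace = (u j * M).trace := by
  rw [Finset.sum_eq_single j (fun i _ hi => by simp [hi]) (by simp), Pi.single_eq_same]

theorem sum_trace_mul_commSum [Fintype I] (u : GaugeLie v) (A : Rep Q v)
    (B : ∀ a, Matrix (Fin (v (Q.tail a))) (Fin (v (Q.head a))) ℂ) :
    ∑ i, (u i * commSum A B i).trace = ∑ a, (infAct A u a * B a).trace := by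
  simp only [commSum, Finset.sum_apply, Pi.sub_apply, Matrix.mul_sum, Matrix.mul_sub,
    Matrix.trace_sum, Matrix.trace_sub]
  rw [Finset.sum_comm]
  refine Finset.sum_congr rfl fun a _ => ?_
  rw [Finset.sum_sub_distrib, sum_trace_mul_single, sum_trace_mul_single, infAct, Matrix.sub_mul,
    Matrix.trace_sub, ← Matrix.mul_assoc, ← Matrix.mul_assoc, Matrix.trace_mul_cycle _ (B a)]

end CommSum

section MomentMap

variable {I : Type u} [DecidableEq I] {E : Type w} {Q : Quiv I E} {v : I → ℕ}

theorem toEnd_mul_toEnd [Fintype I] {i j : I} (M : Matrix (Fin (v i)) (Fin (v j)) ℂ)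
    (N : Matrix (Fin (v j)) (Fin (v i)) ℂ) :
    toEnd M * toEnd N = Matrix.blockDiagonal' (Pi.single i (M * N) : GaugeLie v) := by
  ext ⟨k, p⟩ ⟨l, q⟩
  rw [Matrix.mul_apply, Fintype.sum_sigma, Matrix.blockDiagonal'_apply]
  by_cases hk : k = i
  · subst hk
    rw [Finset.sum_eq_single j (fun r _ hr => by simp [toEnd, hr]) (by simp)]
    by_cases hl : k = l
    · subst hl
      simp [toEnd, Matrix.mul_apply]
    · simp [toEnd, hl, Ne.symm hl]
  · simp [toEnd, hk]

theorem conjTranspose_toEnd {i j : I} (M : Matrix (Fin (v i)) (Fin (v j)) ℂ) :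
    (toEnd M)ᴴ = toEnd Mᴴ := by
  ext p q
  simp only [Matrix.conjTranspose_apply, toEnd, and_comm]
  split_ifs <;> simp

end MomentMap

section Components

variable {I : Type u} {E : Type w} {Q : Quiv I E} {v : I → ℕ}

/-- The component `A` of a representation `(A, B)` of the doubled quiver. -/
def forwardPart (x : Rep Q.double v) : Rep Q v := fun a => x (Sum.inl a)

/-- The component `B` of a representation `(A, B)` of the doubled quiver. -/
def backwardPart (x : Rep Q.double v) (a : E) :
    Matrix (Fin (v (Q.tail a))) (Fin (v (Q.head a))) ℂ := x (Sum.inr a)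

theorem metric_zero_left [Fintype E] (X : Rep Q v) : metric 0 X = 0 := by
  simp [metric]

end Components

section MomentMap

variable {I : Type u} [DecidableEq I] {E : Type w} [Fintype E] {Q : Quiv I E} {v : I → ℕ}

/-- The diagonal blocks of `∑_a [A_a, B_a^*]`, as a real bilinear map. -/
def crossMoment : Rep Q v →ₗ[ℝ] Rep Q v →ₗ[ℝ] GaugeLie v :=
  LinearMap.mk₂ ℝ (fun A B => commSum A fun a => (B a)ᴴ)
    (fun A A' B => by
      simp only [commSum, Pi.add_apply, Matrix.add_mul, Matrix.mul_add, Pi.single_add,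
        ← Finset.sum_add_distrib, add_sub_add_comm])
    (fun t A B => by
      simp only [commSum, Pi.smul_apply, Matrix.smul_mul, Matrix.mul_smul, Pi.single_smul,
        Finset.smul_sum, smul_sub])
    (fun A B B' => by
      simp only [commSum, Pi.add_apply, Matrix.conjTranspose_add, Matrix.add_mul, Matrix.mul_add,
        Pi.single_add, ← Finset.sum_add_distrib, add_sub_add_comm])
    (fun t A B => by
      simp only [commSum, Pi.smul_apply, Matrix.conjTranspose_smul, star_trivial, Matrix.smul_mul,
        Matrix.mul_smul, Pi.single_smul, Finset.smul_sum, smul_sub])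

theorem crossMoment_apply (A B : Rep Q v) :
    crossMoment A B = commSum A fun a => (B a)ᴴ := rfl

theorem conjTranspose_crossMoment (A B : Rep Q v) (i : I) :
    (crossMoment A B i)ᴴ = crossMoment B A i := by
  have h : ∀ (j : I) (M : Matrix (Fin (v j)) (Fin (v j)) ℂ),
      ((Pi.single j M : GaugeLie v) i)ᴴ = (Pi.single j Mᴴ : GaugeLie v) i := fun j M =>
    Pi.apply_single (fun i (N : Matrix (Fin (v i)) (Fin (v i)) ℂ) => Nᴴ)
      (fun _ => Matrix.conjTranspose_zero) j M i
  simp only [crossMoment_apply, commSum, Finset.sum_apply, Pi.sub_apply, Matrix.conjTranspose_sum,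
    Matrix.conjTranspose_sub, h, Matrix.conjTranspose_mul, Matrix.conjTranspose_conjTranspose]

variable [Fintype I]

/-- The moment map property. -/
theorem metric_infAct (A B : Rep Q v) (u : GaugeLie v) :
    metric (infAct A u) B = traceForm u (crossMoment B A) := by
  simp only [metric, traceForm_apply, ← Complex.re_sum]
  rw [← sum_trace_mul_commSum u A fun a => (B a)ᴴ]
  simp only [conjTranspose_crossMoment]
  rfl

theorem sum_trace_crossMoment (A B : Rep Q v) : ∑ i, (crossMoment A B i).trace = 0 := by
  simpa [infAct, crossMoment_apply] using sum_trace_mul_commSum 1 A fun a => (B a)ᴴ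

theorem sum_comm_toEnd (A : Rep Q v)
    (B : ∀ a, Matrix (Fin (v (Q.tail a))) (Fin (v (Q.head a))) ℂ) :
    ∑ a, comm (toEnd (A a)) (toEnd (B a)) = Matrix.blockDiagonal' (commSum A B) := by
  simp only [comm, toEnd_mul_toEnd, ← Matrix.blockDiagonal'_sub]
  exact (map_sum (Matrix.blockDiagonal'AddMonoidHom (fun i => Fin (v i)) (fun i => Fin (v i)) ℂ)
    _ _).symm

theorem momentMap_eq (A : Rep Q v) :
    momentMap A = (1 / (2 * Complex.I)) • Matrix.blockDiagonal' (crossMoment A A) := by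
  simp only [momentMap, conjTranspose_toEnd, sum_comm_toEnd, crossMoment_apply]

theorem complexMomentMap_eq_zero_iff {x : Rep Q.double v} :
    complexMomentMap x = 0 ↔ commSum (forwardPart x) (backwardPart x) = 0 := by
  rw [← Matrix.blockDiagonal'_inj, Matrix.blockDiagonal'_zero, ← sum_comm_toEnd]
  rfl

end MomentMap

section Energy

theorem hasDerivAt_polynomial_zero (a b c d e : ℝ) :
    HasDerivAt (fun t : ℝ => a + b * t + c * t ^ 2 + d * t ^ 3 + e * t ^ 4) b 0 := by
  have := (((((hasDerivAt_id (0 : ℝ)).const_mul b).const_add a).add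
    ((hasDerivAt_pow 2 (0 : ℝ)).const_mul c)).add ((hasDerivAt_pow 3 (0 : ℝ)).const_mul d)).add
    ((hasDerivAt_pow 4 (0 : ℝ)).const_mul e)
  convert! this using 1
  simp

variable {I : Type u} [DecidableEq I] {E : Type w} [Fintype E] {Q : Quiv I E} {v : I → ℕ}

/-- The diagonal blocks of the Hermitian matrix `-i (μ(A) - α)`. -/
def defect (α : I → ℤ) (A : Rep Q v) : GaugeLie v :=
  (-(1 / 2) : ℝ) • crossMoment A A - fun i => (α i : ℂ) • 1

theorem defect_apply (α : I → ℤ) (A : Rep Q v) (i : I) :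
    defect α A i = (-(1 / 2) : ℝ) • crossMoment A A i - (α i : ℂ) • 1 := rfl

theorem conjTranspose_defect (α : I → ℤ) (A : Rep Q v) (i : I) :
    (defect α A i)ᴴ = defect α A i := by
  simp [defect_apply, conjTranspose_crossMoment]

/-- The polarization of `∑_a [A_a, A_a^*]`. -/
def polarMoment : Rep Q v →ₗ[ℝ] Rep Q v →ₗ[ℝ] GaugeLie v :=
  crossMoment (Q := Q) (v := v) + (crossMoment (Q := Q) (v := v)).flip

theorem polarMoment_apply (A X : Rep Q v) :
    polarMoment A X = crossMoment A X + crossMoment X A := rfl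

theorem polarMoment_comm (A X : Rep Q v) : polarMoment A X = polarMoment X A := add_comm _ _

theorem defect_add_smul (α : I → ℤ) (A X : Rep Q v) (t : ℝ) :
    defect α (A + t • X) = defect α A + t • ((-(1 / 2) : ℝ) • polarMoment A X) +
      t ^ 2 • ((-(1 / 2) : ℝ) • crossMoment X X) := by
  simp only [defect, polarMoment_apply, map_add, map_smul, LinearMap.add_apply,
    LinearMap.smul_apply]
  module

variable [Fintype I]

theorem traceForm_defect_polarMoment (α : I → ℤ) (A X Y : Rep Q v) :
    traceForm (defect α A) (polarMoment X Y) = 2 * metric (infAct X (defect α A)) Y := by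
  have hsymm : traceForm (defect α A) (crossMoment X Y) =
      traceForm (defect α A) (crossMoment Y X) := by
    refine (traceForm_comm _ _).trans (Finset.sum_congr rfl fun i _ => ?_)
    rw [conjTranspose_defect, Matrix.trace_mul_comm, conjTranspose_crossMoment]
  rw [polarMoment_apply, map_add, hsymm, metric_infAct, two_mul]

theorem energy_eq (α : I → ℤ) (A : Rep Q v) :
    energy α A = traceForm (defect α A) (defect α A) := by
  have hdiff : momentMap A - centralElement v α =
      Matrix.blockDiagonal' (Complex.I • defect α A) := by
    have hcentral : centralElement v α = Matrix.blockDiagonal'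
        fun i => (Complex.I * α i) • (1 : Matrix (Fin (v i)) (Fin (v i)) ℂ) := by
      simp only [centralElement, Matrix.smul_one_eq_diagonal, Matrix.blockDiagonal'_diagonal]
    rw [momentMap_eq, hcentral, ← Matrix.blockDiagonal'_smul, ← Matrix.blockDiagonal'_sub]
    congr 1
    ext i p q
    simp [defect_apply]
    ring
  simp only [energy, hdiff, Fintype.sum_sigma, traceForm_self]
  refine Finset.sum_congr rfl fun i _ => Finset.sum_congr rfl fun p _ => ?_
  rw [Finset.sum_eq_single i (fun j _ hj => by simp [Matrix.blockDiagonal'_apply_ne _ _ _ hj.symm])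
    (by simp)]
  simp

theorem hasDerivAt_energy (α : I → ℤ) (A X : Rep Q v) :
    HasDerivAt (fun t : ℝ => energy α (A + t • X))
      (-traceForm (defect α A) (polarMoment A X)) 0 := by
  set D := defect α A with hD
  set L := polarMoment A X with hL
  set S := crossMoment X X with hS
  convert! hasDerivAt_polynomial_zero (traceForm D D) (-traceForm D L)
    (-traceForm D S + traceForm L L / 4) (traceForm L S / 2) (traceForm S S / 4) using 1
  funext t
  simp only [energy_eq, defect_add_smul, ← hD, ← hL, ← hS, map_add, map_smul,
    LinearMap.add_apply, LinearMap.smul_apply, smul_eq_mul, traceForm_comm L D,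
    traceForm_comm S D, traceForm_comm S L]
  ring

theorem isCritical_iff (α : I → ℤ) (A : Rep Q v) :
    IsCritical α A ↔ infAct A (defect α A) = 0 := by
  constructor
  · intro h
    have h0 := (hasDerivAt_energy α A (infAct A (defect α A))).unique (h _)
    rw [traceForm_defect_polarMoment, neg_eq_zero, mul_eq_zero] at h0
    exact eq_zero_of_traceForm_self (h0.resolve_left two_ne_zero)
  · intro h X
    have hX := hasDerivAt_energy α A X
    rwa [traceForm_defect_polarMoment, h, metric_zero_left, mul_zero, neg_zero] at hX

theorem hessian_eq (α : I → ℤ) (A X Y : Rep Q v) :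
    hessian α A X Y = traceForm (polarMoment A X) (polarMoment A Y) / 2 -
      2 * metric (infAct X (defect α A)) Y := by
  have hderiv : (fun s : ℝ => deriv (fun t : ℝ => energy α (A + s • X + t • Y)) 0) =
      fun s : ℝ => -traceForm (defect α (A + s • X)) (polarMoment (A + s • X) Y) :=
    funext fun s => (hasDerivAt_energy α (A + s • X) Y).deriv
  rw [hessian, hderiv, ← traceForm_defect_polarMoment]
  refine HasDerivAt.deriv ?_
  set D := defect α A with hD
  set L := polarMoment A X with hL
  set S := crossMoment X X with hS
  set K := polarMoment A Y with hK
  set M := polarMoment X Y with hM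
  convert! hasDerivAt_polynomial_zero (-traceForm D K) (traceForm L K / 2 - traceForm D M)
    (traceForm L M / 2 + traceForm S K / 2) (traceForm S M / 2) 0 using 1
  funext s
  simp only [defect_add_smul, ← hD, ← hL, ← hS, map_add, map_smul, LinearMap.add_apply,
    LinearMap.smul_apply, smul_eq_mul, ← hK, ← hM]
  ring

theorem hessian_comm (α : I → ℤ) (A X Y : Rep Q v) : hessian α A X Y = hessian α A Y X := by
  rw [hessian_eq, hessian_eq, traceForm_comm, ← traceForm_defect_polarMoment,
    ← traceForm_defect_polarMoment, polarMoment_comm X Y]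

theorem hessian_of_orthogonal (α : I → ℤ) {A δ : Rep Q v}
    (h : ∀ u : GaugeLie v, metric (infAct A u) δ = 0) (Y : Rep Q v) :
    hessian α A δ Y = -2 * metric (infAct δ (defect α A)) Y := by
  have hδA : crossMoment δ A = 0 :=
    eq_zero_of_traceForm_self ((metric_infAct A δ _).symm.trans (h _))
  have hAδ : crossMoment A δ = 0 := funext fun i => by
    rw [← conjTranspose_crossMoment, hδA]
    exact Matrix.conjTranspose_zero
  rw [hessian_eq, polarMoment_apply, hδA, hAδ, add_zero, LinearMap.map_zero₂]
  ring

theorem metric_eq_zero_of_mem_negSpace (α : I → ℤ) {A X δ : Rep Q v} {l : ℝ} (hl : 0 ≤ l)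
    (hX : ∀ Y, hessian α A X Y = l * metric X Y) (hδ : δ ∈ negSpace α A) : metric δ X = 0 := by
  suffices negSpace α A ≤ LinearMap.ker ((traceForm (m := fun a => Fin (v (Q.head a)))
    (n := fun a => Fin (v (Q.tail a)))).flip X) from this hδ
  refine iSup_le fun m => Submodule.span_le.2 fun Y hY => ?_
  have hYX : (m : ℝ) * metric Y X = l * metric Y X := by
    rw [← hY X, hessian_comm, hX]
    exact congrArg (l * ·) (traceForm_comm X Y)
  exact (mul_eq_mul_right_iff.1 hYX).resolve_left (m.2.trans_le hl).ne

theorem mem_negSpace_of_eigenvector (α : I → ℤ) {A X : Rep Q v} {l : ℝ} (hl : l < 0)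
    (hX : ∀ Y, hessian α A X Y = l * metric X Y) : X ∈ negSpace α A :=
  Submodule.mem_iSup_of_mem (⟨l, hl⟩ : Set.Iio (0 : ℝ)) (Submodule.subset_span hX)

end Energy

section PolyFun

variable {I : Type u} {E : Type w} {Q : Quiv I E} {v : I → ℕ}

/-- The algebra of polynomial functions on `Rep(Q, v)`. -/
def polyFun (Q : Quiv I E) (v : I → ℕ) : Subalgebra ℂ (Rep Q v → ℂ) :=
  Algebra.adjoin ℂ {f | ∃ a p q, f = fun y => y a p q}

theorem coord_mem_polyFun (a : E) (p : Fin (v (Q.head a))) (q : Fin (v (Q.tail a))) :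
    (fun y => y a p q) ∈ polyFun Q v :=
  Algebra.subset_adjoin ⟨a, p, q, rfl⟩

theorem det_mem_polyFun {n : ℕ} {M : Rep Q v → Matrix (Fin n) (Fin n) ℂ}
    (hM : ∀ p q, (fun y => M y p q) ∈ polyFun Q v) : (fun y => (M y).det) ∈ polyFun Q v := by
  have hdet : (fun y => (M y).det) = ∑ σ : Equiv.Perm (Fin n),
      (((Equiv.Perm.sign σ : ℤ) : ℂ) • ∏ p, fun y => M y (σ p) p) := by
    funext y
    simp [Matrix.det_apply']
  rw [hdet]
  exact sum_mem fun σ _ => Subalgebra.smul_mem _ (prod_mem fun p _ => hM _ _) _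

theorem continuous_of_mem_polyFun {f : Rep Q v → ℂ} (hf : f ∈ polyFun Q v) : Continuous f := by
  induction hf using Algebra.adjoin_induction with
  | mem f hf =>
    obtain ⟨a, p, q, rfl⟩ := hf
    fun_prop
  | algebraMap c => exact continuous_const
  | add f g _ _ hf hg => exact hf.add hg
  | mul f g _ _ hf hg => exact hf.mul hg

variable [Fintype E]

theorem metric_self_nonneg (y : Rep Q v) : 0 ≤ metric y y := traceForm_self_nonneg y

theorem continuous_metric_self : Continuous fun y : Rep Q v => metric y y := by
  unfold metric
  fun_prop

theorem exists_norm_le_of_mem_polyFun {f : Rep Q v → ℂ} (hf : f ∈ polyFun Q v) :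
    ∃ (C : ℝ) (N : ℕ), 0 ≤ C ∧ ∀ y, ‖f y‖ ≤ C * (1 + metric y y) ^ N := by
  induction hf using Algebra.adjoin_induction with
  | mem f hf =>
    obtain ⟨a, p, q, rfl⟩ := hf
    refine ⟨1, 1, zero_le_one, fun y => ?_⟩
    have hy : ‖y a p q‖ ^ 2 ≤ metric y y := norm_sq_le_traceForm_self y a p q
    nlinarith [sq_nonneg (‖y a p q‖ - 1)]
  | algebraMap c => exact ⟨‖c‖, 0, norm_nonneg c, fun y => by simp⟩
  | add f g _ _ hf hg =>
    obtain ⟨C, N, hC, hf⟩ := hf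
    obtain ⟨D, M, hD, hg⟩ := hg
    refine ⟨C + D, N + M, add_nonneg hC hD, fun y => ?_⟩
    have hy : 1 ≤ 1 + metric y y := by linarith [metric_self_nonneg y]
    calc ‖f y + g y‖ ≤ ‖f y‖ + ‖g y‖ := norm_add_le _ _
      _ ≤ C * (1 + metric y y) ^ N + D * (1 + metric y y) ^ M := add_le_add (hf y) (hg y)
      _ ≤ C * (1 + metric y y) ^ (N + M) + D * (1 + metric y y) ^ (N + M) := by
        gcongr <;> first | exact hy | omega
      _ = (C + D) * (1 + metric y y) ^ (N + M) := by ring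
  | mul f g _ _ hf hg =>
    obtain ⟨C, N, hC, hf⟩ := hf
    obtain ⟨D, M, hD, hg⟩ := hg
    refine ⟨C * D, N + M, mul_nonneg hC hD, fun y => ?_⟩
    calc ‖f y * g y‖ = ‖f y‖ * ‖g y‖ := norm_mul _ _
      _ ≤ (C * (1 + metric y y) ^ N) * (D * (1 + metric y y) ^ M) :=
        mul_le_mul (hf y) (hg y) (norm_nonneg _) ((norm_nonneg _).trans (hf y))
      _ = C * D * (1 + metric y y) ^ (N + M) := by ring

end PolyFun

section Costable

variable {I : Type u} {E : Type w} {Q : Quiv I E} {v : I → ℕ}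

/-- A representation is costable if it has no nonzero subrepresentation that vanishes at `o`. -/
def Costable (o : I) (x : Rep Q v) : Prop :=
  ∀ W : ∀ i, Submodule ℂ (Fin (v i) → ℂ),
    (∀ a, ∀ w ∈ W (Q.tail a), x a *ᵥ w ∈ W (Q.head a)) → W o = ⊥ → ∀ i, W i = ⊥

/-- `h` is a homomorphism of representations from `y` to `x`. -/
def Intertwines (h : GaugeLie v) (y x : Rep Q v) : Prop :=
  ∀ a, h (Q.head a) * y a = x a * h (Q.tail a)

theorem Costable.eq_zero_of_intertwines {o : I} {x : Rep Q v} (hx : Costable o x)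
    {h : GaugeLie v} {y : Rep Q v} (hh : Intertwines h y x) (ho : h o = 0) : h = 0 := by
  have hrange := hx (fun i => LinearMap.range (h i).mulVecLin) ?_ (by simp [ho])
  · funext i
    exact (LinearEquiv.map_eq_zero_iff Matrix.toLin').1 (LinearMap.range_eq_bot.1 (hrange i))
  · rintro a _ ⟨w, rfl⟩
    exact ⟨y a *ᵥ w, by simp only [Matrix.mulVecLin_apply, Matrix.mulVec_mulVec, hh a]⟩

theorem Costable.of_intertwines_of_injective {o : I} {x y : Rep Q v} (hx : Costable o x)
    {h : GaugeLie v} (hh : Intertwines h y x) (hinj : ∀ i, Function.Injective (h i).mulVec) :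
    Costable o y := by
  intro W hW ho i
  refine Submodule.map_injective_of_injective (f := (h i).mulVecLin) (hinj i)
    ((hx (fun i => (W i).map (h i).mulVecLin) ?_ (by simp [ho]) i).trans
      (Submodule.map_bot _).symm)
  rintro a _ ⟨w, hw, rfl⟩
  refine ⟨y a *ᵥ w, hW a w hw, ?_⟩
  simp only [Matrix.mulVecLin_apply, Matrix.mulVec_mulVec, hh a]

theorem intertwines_inv_iff (g : Gauge v) {x y : Rep Q v} :
    Intertwines (fun i => ((g⁻¹ i : GL (Fin (v i)) ℂ) : Matrix (Fin (v i)) (Fin (v i)) ℂ)) y x ↔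
      act g x = y := by
  simp only [Intertwines, funext_iff (f := act g x), act, Pi.inv_apply]
  refine forall_congr' fun a => ⟨fun h => ?_, fun h => ?_⟩
  · rw [Matrix.mul_assoc, ← h, ← Matrix.mul_assoc, Units.mul_inv, Matrix.one_mul]
  · rw [← h, ← Matrix.mul_assoc, ← Matrix.mul_assoc, Units.inv_mul, Matrix.one_mul]

theorem Costable.gauge {o : I} {x : Rep Q v} (hx : Costable o x) (g : Gauge v) :
    Costable o (act g x) :=
  hx.of_intertwines_of_injective ((intertwines_inv_iff g).2 rfl) fun i =>
    Matrix.mulVec_injective_of_isUnit (g⁻¹ i).isUnit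

/-- The covectors `φ` at the vertex `i` such that, for the homomorphisms `h : y → x` that are
the identity at `o`, the covector `φ ∘ h` is a polynomial function of `y`. -/
def polyDetermined (o : I) (x : Rep Q v) (i : I) : Submodule ℂ (Fin (v i) → ℂ) where
  carrier := {φ | ∃ F : Fin (v i) → polyFun Q v, ∀ (h : GaugeLie v) y, h o = 1 →
    Intertwines h y x → ∀ q, (φ ᵥ* h i) q = (F q).1 y}
  add_mem' := by
    rintro φ ψ ⟨F, hF⟩ ⟨G, hG⟩
    exact ⟨F + G, fun h y ho hh q => by
      simp [Matrix.add_vecMul, hF h y ho hh, hG h y ho hh]⟩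
  zero_mem' := ⟨0, fun h y _ _ q => by simp⟩
  smul_mem' := by
    rintro c φ ⟨F, hF⟩
    exact ⟨c • F, fun h y ho hh q => by simp [Matrix.smul_vecMul, hF h y ho hh]⟩

theorem polyDetermined_self (o : I) (x : Rep Q v) : polyDetermined o x o = ⊤ :=
  eq_top_iff.2 fun φ _ => ⟨fun q => algebraMap ℂ _ (φ q), fun h y ho _ q => by
    simp [ho]⟩

theorem vecMul_mem_polyDetermined {o : I} {x : Rep Q v} (a : E) {φ : Fin (v (Q.head a)) → ℂ}
    (hφ : φ ∈ polyDetermined o x (Q.head a)) : φ ᵥ* x a ∈ polyDetermined o x (Q.tail a) := by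
  obtain ⟨F, hF⟩ := hφ
  refine ⟨fun q => ∑ p, F p * ⟨_, coord_mem_polyFun a p q⟩, fun h y ho hh q => ?_⟩
  rw [Matrix.vecMul_vecMul, ← hh a, ← Matrix.vecMul_vecMul]
  simp [Matrix.vecMul, dotProduct, ← hF h y ho hh]

theorem Costable.polyDetermined_eq_top {o : I} {x : Rep Q v} (hx : Costable o x) (i : I) :
    polyDetermined o x i = ⊤ := by
  let e := fun i => dotProductEquiv ℂ (Fin (v i))
  have hbot := hx (fun i => ((polyDetermined o x i).map (e i).toLinearMap).dualCoannihilator) ?_ ?_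
  · have htop := congrArg Submodule.dualAnnihilator (hbot i)
    rw [Subspace.dualCoannihilator_dualAnnihilator_eq, Submodule.dualAnnihilator_bot] at htop
    rwa [← Submodule.map_eq_top_iff (e := e i)]
  · intro a w hw
    rw [Submodule.mem_dualCoannihilator] at hw ⊢
    rintro _ ⟨φ, hφ, rfl⟩
    simpa [e, dotProductEquiv, Matrix.dotProduct_mulVec] using
      hw _ ⟨_, vecMul_mem_polyDetermined a hφ, rfl⟩
  · rw [polyDetermined_self, Submodule.map_top, LinearEquiv.range,
      Submodule.dualCoannihilator_top]

theorem Costable.exists_reconstruction {o : I} {x : Rep Q v} (hx : Costable o x) :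
    ∃ F : Rep Q v → GaugeLie v, (∀ i p q, (fun y => F y i p q) ∈ polyFun Q v) ∧
      ∀ h y, h o = 1 → Intertwines h y x → h = F y := by
  choose F hF using fun i (p : Fin (v i)) =>
    (hx.polyDetermined_eq_top i).symm ▸ Submodule.mem_top (x := Pi.single p (1 : ℂ))
  refine ⟨fun y i p q => (F i p q).1 y, fun i p q => (F i p q).2, fun h y ho hh => ?_⟩
  funext i p q
  simpa using hF i p h y ho hh q

end Costable

section Scalars

variable {I : Type u} {E : Type w} {Q : Quiv I E} {v : I → ℕ}

theorem eq_det_smul_one {n : ℕ} (hn : n = 1) (M : Matrix (Fin n) (Fin n) ℂ) : M = M.det • 1 := by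
  subst hn
  ext p q
  obtain rfl := Subsingleton.elim p 0
  obtain rfl := Subsingleton.elim q 0
  simp

/-- The scalar `c` as an element of `G_v`. -/
def scalarGauge (v : I → ℕ) (c : ℂˣ) : Gauge v := fun i =>
  Units.map (algebraMap ℂ (Matrix (Fin (v i)) (Fin (v i)) ℂ)).toMonoidHom c

theorem coe_scalarGauge (c : ℂˣ) (i : I) :
    (scalarGauge v c i : Matrix (Fin (v i)) (Fin (v i)) ℂ) = (c : ℂ) • 1 := by
  simp [scalarGauge, Algebra.algebraMap_eq_smul_one]

theorem coe_scalarGauge_inv (c : ℂˣ) (i : I) :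
    (((scalarGauge v c i)⁻¹ : GL (Fin (v i)) ℂ) : Matrix (Fin (v i)) (Fin (v i)) ℂ) =
      (c : ℂ)⁻¹ • 1 := by
  have hinv : (scalarGauge v c i)⁻¹ = scalarGauge v c⁻¹ i := by simp [scalarGauge]
  rw [hinv, coe_scalarGauge, Units.val_inv_eq_inv_val]

theorem act_scalarGauge (c : ℂˣ) (x : Rep Q v) : act (scalarGauge v c) x = x := by
  funext a
  rw [act, coe_scalarGauge, coe_scalarGauge_inv]
  simp [smul_smul]

theorem exists_eq_scalarGauge_mul {o : I} (hv : v o = 1) (g : Gauge v) :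
    ∃ (c : ℂˣ) (g' : Gauge v), g = scalarGauge v c * g' ∧ g' o = 1 := by
  let c : ℂˣ := Matrix.GeneralLinearGroup.det (g o)
  refine ⟨c, (scalarGauge v c)⁻¹ * g, by simp, ?_⟩
  have hgo : g o = scalarGauge v c o := by
    ext1
    rw [coe_scalarGauge]
    exact eq_det_smul_one hv _
  rw [Pi.mul_apply, Pi.inv_apply, ← hgo, inv_mul_cancel]

theorem exists_gauge_inv_eq {h : GaugeLie v} (hne : ∀ i, (h i).det ≠ 0) :
    ∃ g : Gauge v,
      (fun i => ((g⁻¹ i : GL (Fin (v i)) ℂ) : Matrix (Fin (v i)) (Fin (v i)) ℂ)) = h :=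
  ⟨fun i => (Matrix.GeneralLinearGroup.mkOfDetNeZero _ (hne i))⁻¹,
    funext fun i => by rw [Pi.inv_apply, inv_inv]; rfl⟩

variable [Fintype I]

theorem prod_det_mul_prod_det_inv (g : Gauge v) :
    (∏ i, (g i : Matrix (Fin (v i)) (Fin (v i)) ℂ).det) *
      ∏ i, ((g⁻¹ i : GL (Fin (v i)) ℂ) : Matrix (Fin (v i)) (Fin (v i)) ℂ).det = 1 := by
  rw [← Finset.prod_mul_distrib]
  refine Finset.prod_eq_one fun i _ => ?_
  rw [← Matrix.det_mul, Pi.inv_apply, Units.mul_inv, Matrix.det_one]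

theorem character_mul (α : I → ℤ) (g h : Gauge v) :
    character α (g * h) = character α g * character α h := by
  simp only [character, Pi.mul_apply, Units.val_mul, Matrix.det_mul, mul_zpow,
    Finset.prod_mul_distrib]

theorem character_scalarGauge (α : I → ℤ) (c : ℂˣ) :
    character α (scalarGauge v c) = (c : ℂ) ^ ∑ i, α i * (v i : ℤ) := by
  have hzpow : (c : ℂ) ^ ∑ i, α i * (v i : ℤ) = ∏ i, (c : ℂ) ^ (α i * (v i : ℤ)) := by
    induction (Finset.univ : Finset I) using Finset.cons_induction with
    | empty => simp
    | cons i s hi ih => rw [Finset.prod_cons, Finset.sum_cons, zpow_add₀ c.ne_zero, ih]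
  rw [hzpow]
  refine Finset.prod_congr rfl fun i _ => ?_
  rw [coe_scalarGauge, Matrix.det_smul, Matrix.det_one, mul_one, Fintype.card_fin,
    mul_comm (α i), zpow_mul, zpow_natCast]

variable [DecidableEq I]

theorem sum_canonicalParam_mul {o : I} (hv : v o = 1) :
    ∑ i, canonicalParam o v i * (v i : ℤ) = 0 := by
  have hne : ∀ i ∈ Finset.univ.erase o, canonicalParam o v i * (v i : ℤ) = v i := fun i hi => by
    simp [canonicalParam, Finset.ne_of_mem_erase hi]
  rw [← Finset.add_sum_erase _ _ (Finset.mem_univ o), Finset.sum_congr rfl hne]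
  simp [canonicalParam, hv]

theorem character_canonicalParam {o : I} {g : Gauge v} (hg : g o = 1) :
    character (canonicalParam o v) g =
      ∏ i, (g i : Matrix (Fin (v i)) (Fin (v i)) ℂ).det := by
  refine Finset.prod_congr rfl fun i _ => ?_
  by_cases hi : i = o
  · subst hi
    simp [hg]
  · simp [canonicalParam, hi]

theorem exists_act_eq_act_of_dim_eq_one {o : I} (hv : v o = 1) (g : Gauge v) (x : Rep Q v) :
    ∃ g' : Gauge v, g' o = 1 ∧ act g' x = act g x ∧
      character (canonicalParam o v) g' = character (canonicalParam o v) g := by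
  obtain ⟨c, g', rfl, ho⟩ := exists_eq_scalarGauge_mul hv g
  refine ⟨g', ho, ?_, ?_⟩
  · rw [act_mul, act_scalarGauge]
  · rw [character_mul, character_scalarGauge, sum_canonicalParam_mul hv, zpow_zero, one_mul]

end Scalars

section Semistable

variable {I : Type u} {E : Type w} {Q : Quiv I E} {v : I → ℕ}

theorem exists_projection {n : ℕ} (W : Submodule ℂ (Fin n → ℂ)) :
    ∃ P : Matrix (Fin n) (Fin n) ℂ, (∀ w, P *ᵥ w ∈ W) ∧ (∀ w ∈ W, P *ᵥ w = w) := by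
  obtain ⟨W', h⟩ := W.exists_isCompl
  refine ⟨LinearMap.toMatrix' (W.subtype ∘ₗ W.projectionOnto W' h), fun w => ?_,
    fun w hw => ?_⟩
  · rw [LinearMap.toMatrix'_mulVec]
    exact (W.projectionOnto W' h w).2
  · have hw' := Submodule.projectionOnto_apply_left h ⟨w, hw⟩
    rw [LinearMap.toMatrix'_mulVec, LinearMap.comp_apply, hw', Submodule.subtype_apply]

/-- The endomorphism that multiplies the image of the projection `P` by `t` and fixes its
kernel. -/
def scaleRange {n : ℕ} (P : Matrix (Fin n) (Fin n) ℂ) (t : ℂ) : Matrix (Fin n) (Fin n) ℂ :=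
  1 - P + t • P

theorem scaleRange_mul {n : ℕ} {P : Matrix (Fin n) (Fin n) ℂ} (hP : P * P = P) (s t : ℂ) :
    scaleRange P s * scaleRange P t = scaleRange P (s * t) := by
  simp only [scaleRange, Matrix.mul_add, Matrix.add_mul, Matrix.mul_sub, Matrix.sub_mul,
    Matrix.one_mul, Matrix.mul_one, Matrix.mul_smul, Matrix.smul_mul, hP, smul_smul, smul_add,
    smul_sub, mul_comm t s]
  abel

theorem scaleRange_one {n : ℕ} (P : Matrix (Fin n) (Fin n) ℂ) : scaleRange P 1 = 1 := by
  simp [scaleRange]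

/-- The one-parameter family through `x` generated by the projections `P` onto a
subrepresentation; it extends over `t = 0`. -/
def degeneration (P : GaugeLie v) (x : Rep Q v) (t : ℂ) : Rep Q v := fun a =>
  scaleRange (P (Q.head a)) t * x a * (1 - P (Q.tail a)) + x a * P (Q.tail a)

theorem exists_act_eq_degeneration {P : GaugeLie v} (hP : ∀ i, P i * P i = P i) {x : Rep Q v}
    (hx : ∀ a, P (Q.head a) * x a * P (Q.tail a) = x a * P (Q.tail a)) {t : ℂ} (ht : t ≠ 0) :
    ∃ g : Gauge v, (∀ i, (g i : Matrix (Fin (v i)) (Fin (v i)) ℂ) = scaleRange (P i) t) ∧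
      act g x = degeneration P x t := by
  refine ⟨fun i => ⟨scaleRange (P i) t, scaleRange (P i) t⁻¹, ?_, ?_⟩, fun i => rfl, ?_⟩
  · rw [scaleRange_mul (hP i), mul_inv_cancel₀ ht, scaleRange_one]
  · rw [scaleRange_mul (hP i), inv_mul_cancel₀ ht, scaleRange_one]
  · funext a
    have hxP : scaleRange (P (Q.head a)) t * (x a * P (Q.tail a)) = t • (x a * P (Q.tail a)) := by
      rw [scaleRange, Matrix.add_mul, Matrix.sub_mul, Matrix.one_mul, Matrix.smul_mul,
        ← Matrix.mul_assoc, hx a, sub_self, zero_add]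
    change scaleRange (P (Q.head a)) t * x a * scaleRange (P (Q.tail a)) t⁻¹ = _
    rw [degeneration, scaleRange.eq_1 (P (Q.tail a)), Matrix.mul_add, Matrix.mul_smul,
      Matrix.mul_assoc _ (x a) (P _), hxP, inv_smul_smul₀ ht]

variable [Fintype I] [DecidableEq I]

theorem IsSemistable.eq_zero_of_projection {o : I} {x : Rep Q v}
    (hss : IsSemistable (canonicalParam o v) x) {P : GaugeLie v} (hP : ∀ i, P i * P i = P i)
    (hx : ∀ a, P (Q.head a) * x a * P (Q.tail a) = x a * P (Q.tail a)) (ho : P o = 0) : P = 0 := by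
  let γ : ℂ → Rep Q v × ℂ := fun t => (degeneration P x t, ∏ i, (scaleRange (P i) t).det)
  have hγ : Continuous γ := by
    refine .prodMk (continuous_pi fun a => ?_)
      (continuous_finsetProd _ fun i _ => Continuous.matrix_det ?_)
    · unfold degeneration scaleRange
      fun_prop
    · unfold scaleRange
      fun_prop
  have hmaps : Set.MapsTo γ {0}ᶜ (liftedOrbit (canonicalParam o v) x 1) := by
    intro t ht
    obtain ⟨g, hg, hact⟩ := exists_act_eq_degeneration hP hx ht
    have hgo : g o = 1 := Units.ext (by rw [hg, ho]; simp [scaleRange])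
    refine ⟨g, Prod.ext hact ?_⟩
    simp only [γ, mul_one, character_canonicalParam hgo, hg]
  have hlim : γ 0 ∈ closure (liftedOrbit (canonicalParam o v) x 1) :=
    map_mem_closure hγ (by rw [closure_compl_singleton]; trivial) hmaps
  have hdet : ∏ i, (scaleRange (P i) 0).det ≠ 0 := fun h0 =>
    (hss 1 one_ne_zero).subset ⟨hlim, h0⟩
  funext i
  have hdet_i := Finset.prod_ne_zero_iff.1 hdet i (Finset.mem_univ i)
  have hker : ∀ w, P i *ᵥ w = 0 := fun w =>
    Matrix.eq_zero_of_mulVec_eq_zero hdet_i (by simp [scaleRange, Matrix.sub_mul, hP])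
  exact Matrix.toLin'.injective (LinearMap.ext fun w => by simp [hker])

theorem IsSemistable.costable {o : I} {x : Rep Q v}
    (hss : IsSemistable (canonicalParam o v) x) : Costable o x := by
  intro W hW ho
  choose P hPW hP using fun i => exists_projection (W i)
  have hzero : P = 0 := by
    refine hss.eq_zero_of_projection (fun i => ?_) (fun a => ?_) ?_ <;>
      refine Matrix.toLin'.injective (LinearMap.ext fun w => ?_)
    · simpa using hP i _ (hPW i w)
    · simpa [← Matrix.mulVec_mulVec] using hP _ _ (hW a _ (hPW _ w))
    · simpa [ho] using hPW o w
  intro i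
  rw [eq_bot_iff]
  intro w hw
  rw [Submodule.mem_bot, ← hP i w hw, hzero, Pi.zero_apply, Matrix.zero_mulVec]

end Semistable

section Stable

variable {I : Type u} {E : Type w} {Q : Quiv I E} {v : I → ℕ}

theorem Costable.eq_of_intertwines {o : I} {x : Rep Q v} (hx : Costable o x)
    {h h' : GaugeLie v} {y : Rep Q v} (hh : Intertwines h y x) (hh' : Intertwines h' y x)
    (ho : h o = h' o) : h = h' := by
  refine sub_eq_zero.1 (hx.eq_zero_of_intertwines (h := h - h') (y := y) (fun a => ?_) ?_)
  · rw [Pi.sub_apply, Pi.sub_apply, Matrix.sub_mul, Matrix.mul_sub, hh a, hh' a]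
  · rw [Pi.sub_apply, ho, sub_self]

theorem Costable.eq_one_of_act_eq {o : I} {x : Rep Q v} (hx : Costable o x) {g : Gauge v}
    (hg : act g x = x) (ho : g o = 1) : g = 1 := by
  have hinv := hx.eq_of_intertwines ((intertwines_inv_iff g).2 hg)
    (h' := 1) (fun a => by simp) (by simp [ho])
  exact inv_eq_one.1 (funext fun i => Units.ext (congrFun hinv i))

variable [Fintype I] [DecidableEq I]

theorem mem_liftedOrbit_iff {o : I} (hv : v o = 1) {x y : Rep Q v} {ξ η : ℂ} (hξ : ξ ≠ 0) :
    (y, η) ∈ liftedOrbit (canonicalParam o v) x ξ ↔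
      ∃ h : GaugeLie v, h o = 1 ∧ Intertwines h y x ∧ η * ∏ i, (h i).det = ξ := by
  constructor
  · rintro ⟨g, hg⟩
    obtain ⟨g', ho, hact, hchar⟩ := exists_act_eq_act_of_dim_eq_one hv g x
    obtain ⟨rfl, rfl⟩ := Prod.mk.inj hg
    refine ⟨_, by simp [ho], (intertwines_inv_iff g').2 hact, ?_⟩
    rw [← hchar, character_canonicalParam ho, mul_right_comm, prod_det_mul_prod_det_inv, one_mul]
  · rintro ⟨h, ho, hh, hprod⟩
    have hne : ∀ i, (h i).det ≠ 0 := fun i =>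
      Finset.prod_ne_zero_iff.1 (right_ne_zero_of_mul (hprod ▸ hξ)) i (Finset.mem_univ i)
    obtain ⟨g, rfl⟩ := exists_gauge_inv_eq hne
    have hgo : g o = 1 := inv_eq_one.1 (Units.ext ho)
    refine ⟨g, Prod.ext ((intertwines_inv_iff g).1 hh) ?_⟩
    change character (canonicalParam o v) g * ξ = η
    rw [character_canonicalParam hgo, ← hprod, mul_left_comm, prod_det_mul_prod_det_inv, mul_one]

theorem Costable.isClosed_liftedOrbit {o : I} (hv : v o = 1) {x : Rep Q v} (hx : Costable o x)
    {ξ : ℂ} (hξ : ξ ≠ 0) : IsClosed (liftedOrbit (canonicalParam o v) x ξ) := by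
  obtain ⟨F, hF, hFx⟩ := hx.exists_reconstruction
  have hFc : ∀ i, Continuous fun z : Rep Q v × ℂ => F z.1 i := fun i =>
    continuous_pi fun p => continuous_pi fun q =>
      (continuous_of_mem_polyFun (hF i p q)).comp continuous_fst
  have horbit : liftedOrbit (canonicalParam o v) x ξ = {z | F z.1 o = 1} ∩
      ((⋂ a, {z | F z.1 (Q.head a) * z.1 a = x a * F z.1 (Q.tail a)}) ∩
        {z | z.2 * ∏ i, (F z.1 i).det = ξ}) := by
    ext ⟨y, η⟩
    simp only [mem_liftedOrbit_iff hv hξ, Set.mem_inter_iff, Set.mem_iInter, Set.mem_ofPred_eq]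
    constructor
    · rintro ⟨h, ho, hh, hprod⟩
      obtain rfl := hFx h y ho hh
      exact ⟨ho, hh, hprod⟩
    · exact fun h => ⟨F y, h⟩
  rw [horbit]
  refine (isClosed_eq (hFc o) continuous_const).inter ((isClosed_iInter fun a => ?_).inter ?_)
  · exact isClosed_eq ((hFc _).matrix_mul ((continuous_apply a).comp continuous_fst))
      (continuous_const.matrix_mul (hFc _))
  · exact isClosed_eq (continuous_snd.mul
      (continuous_finsetProd _ fun i _ => (hFc i).matrix_det)) continuous_const

theorem Costable.isStable {o : I} (hv : v o = 1) {x : Rep Q v} (hx : Costable o x) :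
    IsStable (canonicalParam o v) x := by
  refine ⟨⟨fun ξ hξ => ?_, fun ξ hξ => hx.isClosed_liftedOrbit hv hξ⟩, fun g hg => ?_⟩
  · rw [(hx.isClosed_liftedOrbit hv hξ).closure_eq, Set.eq_empty_iff_forall_notMem]
    rintro ⟨y, η⟩ ⟨hmem, rfl : η = 0⟩
    obtain ⟨h, -, -, hprod⟩ := (mem_liftedOrbit_iff hv hξ).1 hmem
    exact hξ (by rw [← hprod, zero_mul])
  · obtain ⟨c, g', rfl, ho⟩ := exists_eq_scalarGauge_mul hv g
    rw [act_mul, act_scalarGauge] at hg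
    exact ⟨c, fun i => by rw [hx.eq_one_of_act_eq hg ho, mul_one, coe_scalarGauge]⟩

theorem isStable_iff_costable {o : I} (hv : v o = 1) {x : Rep Q v} :
    IsStable (canonicalParam o v) x ↔ Costable o x :=
  ⟨fun h => h.1.1.costable, fun h => h.isStable hv⟩

end Stable

section Derivatives

theorem hasDerivAt_ofReal_mul {f : ℝ → ℂ} (hf : ContinuousAt f 0) :
    HasDerivAt (fun t : ℝ => (t : ℂ) * f t) (f 0) 0 := by
  rw [hasDerivAt_iff_tendsto_slope_zero]
  refine (hf.tendsto.mono_left nhdsWithin_le_nhds).congr' ?_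
  filter_upwards [self_mem_nhdsWithin] with t ht
  have ht' : (t : ℂ) ≠ 0 := Complex.ofReal_ne_zero.2 ht
  simp [ht']

theorem hasDerivAt_mul_apply {l m n : Type*} [Fintype m] {A : ℝ → Matrix l m ℂ}
    {B : ℝ → Matrix m n ℂ} {A' : Matrix l m ℂ} {B' : Matrix m n ℂ} {t : ℝ}
    (hA : ∀ p q, HasDerivAt (fun s => A s p q) (A' p q) t)
    (hB : ∀ p q, HasDerivAt (fun s => B s p q) (B' p q) t) (p : l) (q : n) :
    HasDerivAt (fun s => (A s * B s) p q) ((A' * B t + A t * B') p q) t := by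
  simp only [Matrix.mul_apply, Matrix.add_apply, ← Finset.sum_add_distrib]
  exact HasDerivAt.fun_sum fun r _ => (hA p r).mul (hB r q)

variable {n : ℕ}

theorem continuousAt_inv_of_det_ne_zero {A : Matrix (Fin n) (Fin n) ℂ} (hA : A.det ≠ 0) :
    ContinuousAt Inv.inv A :=
  continuousAt_matrix_inv A (NormedRing.inverse_continuousAt (Units.mk0 A.det hA))

variable (u : Matrix (Fin n) (Fin n) ℂ)

theorem hasDerivAt_one_add_smul (p q : Fin n) :
    HasDerivAt (fun t : ℝ => (1 + (t : ℂ) • u) p q) (u p q) 0 := by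
  simpa using (hasDerivAt_ofReal_mul (f := fun _ => u p q) continuousAt_const).const_add
    ((1 : Matrix (Fin n) (Fin n) ℂ) p q)

theorem hasDerivAt_det_one_add_smul :
    HasDerivAt (fun t : ℝ => (1 + (t : ℂ) • u).det) u.trace 0 := by
  let f : ℝ → ℂ := fun t => u.trace + Polynomial.eval (t : ℂ)
    (1 + (Polynomial.X : Polynomial ℂ) • u.map Polynomial.C).det.divX.divX * (t : ℂ)
  have hf : Continuous f := continuous_const.add
    (((Polynomial.continuous _).comp Complex.continuous_ofReal).mul Complex.continuous_ofReal)
  convert! (hasDerivAt_ofReal_mul hf.continuousAt).const_add (1 : ℂ) using 1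
  · funext t
    rw [Matrix.det_one_add_smul]
    simp only [f]
    ring
  · simp [f]

theorem eventually_det_one_add_smul_ne_zero :
    ∀ᶠ t : ℝ in nhds 0, (1 + (t : ℂ) • u).det ≠ 0 :=
  (hasDerivAt_det_one_add_smul u).continuousAt.eventually_ne (by simp)

theorem hasDerivAt_one_add_smul_inv (p q : Fin n) :
    HasDerivAt (fun t : ℝ => ((1 + (t : ℂ) • u)⁻¹) p q) ((-u) p q) 0 := by
  have hinv : ContinuousAt (fun t : ℝ => (1 + (t : ℂ) • u)⁻¹) 0 := by
    have hlin : Continuous fun t : ℝ => 1 + (t : ℂ) • u := by fun_prop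
    exact (continuousAt_inv_of_det_ne_zero (by simp)).comp hlin.continuousAt
  have hentry : Continuous fun N : Matrix (Fin n) (Fin n) ℂ => (-(u * N)) p q := by fun_prop
  have hder := (hasDerivAt_ofReal_mul (hentry.continuousAt.comp hinv)).const_add
    ((1 : Matrix (Fin n) (Fin n) ℂ) p q)
  simp only [Function.comp_apply, Complex.ofReal_zero, zero_smul, add_zero, inv_one,
    Matrix.mul_one] at hder
  refine hder.congr_of_eventuallyEq ?_
  filter_upwards [eventually_det_one_add_smul_ne_zero u] with t ht
  have hcancel : (1 + (t : ℂ) • u)⁻¹ = 1 - (t : ℂ) • (u * (1 + (t : ℂ) • u)⁻¹) := by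
    rw [eq_sub_iff_add_eq, ← Matrix.smul_mul, ← one_add_mul, Matrix.mul_nonsing_inv _ ht.isUnit]
  refine (congrFun (congrFun hcancel p) q).trans ?_
  simp [sub_eq_add_neg]

theorem hasDerivAt_log_norm_sq_prod_det {I : Type*} [Fintype I] {v : I → ℕ} (u : GaugeLie v) :
    HasDerivAt (fun t : ℝ => Real.log (‖∏ i, (1 + (t : ℂ) • u i).det‖ ^ 2))
      (2 * ∑ i, (u i).trace.re) 0 := by
  classical
  have hder := (HasDerivAt.fun_finsetProd (u := Finset.univ)
    fun i _ => hasDerivAt_det_one_add_smul (u i)).norm_sq.log (by simp)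
  convert! hder using 1
  simp [Complex.inner]

end Derivatives

section KempfNess

variable {I : Type u} {E : Type w} {Q : Quiv I E} {v : I → ℕ}

/-- The curve `(1 + t u) · y` through `y`; it lies in the orbit of `y` for small `t`. -/
def orbitCurve (y : Rep Q v) (u : GaugeLie v) (t : ℝ) : Rep Q v := fun a =>
  (1 + (t : ℂ) • u (Q.head a)) * y a * (1 + (t : ℂ) • u (Q.tail a))⁻¹

theorem orbitCurve_zero (y : Rep Q v) (u : GaugeLie v) : orbitCurve y u 0 = y := by
  funext a
  simp [orbitCurve]

variable [Fintype E]

theorem hasDerivAt_metric_self {y : ℝ → Rep Q v} {y' : Rep Q v} {t : ℝ}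
    (hy : ∀ a p q, HasDerivAt (fun s => y s a p q) (y' a p q) t) :
    HasDerivAt (fun s => metric (y s) (y s)) (2 * metric (y t) y') t := by
  change HasDerivAt (fun s => traceForm (y s) (y s)) (2 * traceForm (y t) y') t
  simp only [traceForm_self, traceForm_eq_sum_inner, Finset.mul_sum]
  exact HasDerivAt.fun_sum fun a _ => HasDerivAt.fun_sum fun p _ => HasDerivAt.fun_sum fun q _ =>
    (hy a p q).norm_sq

theorem isCompact_metric_self_le (R : ℝ) : IsCompact {y : Rep Q v | metric y y ≤ R} := by
  have hbox : IsCompact (Set.univ.pi fun a : E => Set.univ.pi fun _ : Fin (v (Q.head a)) =>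
      Set.univ.pi fun _ : Fin (v (Q.tail a)) => Metric.closedBall (0 : ℂ) (√R)) :=
    isCompact_univ_pi fun _ => isCompact_univ_pi fun _ => isCompact_univ_pi fun _ =>
      isCompact_closedBall _ _
  refine hbox.of_isClosed_subset (isClosed_le continuous_metric_self continuous_const)
    fun y (hy : metric y y ≤ R) a _ p _ q _ => ?_
  rw [mem_closedBall_zero_iff]
  exact Real.le_sqrt_of_sq_le ((norm_sq_le_traceForm_self y a p q).trans hy)

theorem exists_bound_of_sub_log_le {σ C : ℝ} (hσ : 0 ≤ σ) (hC : 0 < C) (N : ℕ) (c : ℝ) :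
    ∃ R, ∀ n : ℝ, 0 ≤ n → n - σ * Real.log (C * (1 + n) ^ N) ≤ c → n ≤ R := by
  let K : ℝ := 2 * (σ * N) + 1
  have hK : 0 < K := by positivity
  refine ⟨2 * (c + σ * Real.log C + σ * N * Real.log K + 1 / 2), fun n hn h => ?_⟩
  have hn1 : 0 < 1 + n := by linarith
  rw [Real.log_mul hC.ne' (by positivity), Real.log_pow] at h
  have hlog := Real.log_le_sub_one_of_pos (div_pos hn1 hK)
  rw [Real.log_div hn1.ne' hK.ne'] at hlog
  have hmul : σ * N * Real.log (1 + n) ≤ σ * N * ((1 + n) / K + Real.log K) :=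
    mul_le_mul_of_nonneg_left (by linarith) (by positivity)
  have hhalf : σ * N * ((1 + n) / K) ≤ (1 + n) / 2 := by
    rw [mul_div_assoc', div_le_div_iff₀ hK two_pos]
    nlinarith
  nlinarith

theorem exists_metric_self_le {D : Rep Q v → ℂ} (hD : D ∈ polyFun Q v) {σ : ℝ} (hσ : 0 ≤ σ)
    (c : ℝ) : ∃ R, ∀ y, D y ≠ 0 → metric y y - σ * Real.log (‖D y‖ ^ 2) ≤ c →
      metric y y ≤ R := by
  obtain ⟨C, N, hC, hle⟩ := exists_norm_le_of_mem_polyFun hD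
  obtain ⟨R, hR⟩ := exists_bound_of_sub_log_le hσ (show 0 < (C + 1) ^ 2 by positivity) (2 * N) c
  refine ⟨R, fun y hy hc => hR _ (metric_self_nonneg y) (le_trans ?_ hc)⟩
  have hy0 := metric_self_nonneg y
  have hsq : ‖D y‖ ^ 2 ≤ (C + 1) ^ 2 * (1 + metric y y) ^ (2 * N) :=
    calc ‖D y‖ ^ 2 ≤ (C * (1 + metric y y) ^ N) ^ 2 := by gcongr; exact hle y
      _ ≤ ((C + 1) * (1 + metric y y) ^ N) ^ 2 := by gcongr; linarith
      _ = _ := by ring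
  gcongr

theorem exists_isMinOn_metric_sub_log {D : Rep Q v → ℂ} (hD : D ∈ polyFun Q v)
    {Z : Set (Rep Q v)} (hZ : IsClosed Z) {x : Rep Q v} (hx : x ∈ Z) (hx0 : D x ≠ 0) {σ : ℝ}
    (hσ : 0 < σ) : ∃ y ∈ Z ∩ {y | D y ≠ 0},
      IsMinOn (fun y => metric y y - σ * Real.log (‖D y‖ ^ 2)) (Z ∩ {y | D y ≠ 0}) y := by
  let φ : Rep Q v → ℝ := fun y => metric y y - σ * Real.log (‖D y‖ ^ 2)
  have hDc := continuous_of_mem_polyFun hD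
  obtain ⟨R, hR⟩ := exists_metric_self_le hD hσ.le (φ x)
  let K : Set (Rep Q v) := Z ∩ ({y | Real.exp (-φ x / σ) ≤ ‖D y‖ ^ 2} ∩ {y | metric y y ≤ R})
  have hK : IsCompact K := ((isCompact_metric_self_le R).inter_left
    (isClosed_le continuous_const (hDc.norm.pow 2))).inter_left hZ
  have hK0 : ∀ y ∈ K, ‖D y‖ ^ 2 ≠ 0 := fun y hy => ((Real.exp_pos _).trans_le hy.2.1).ne'
  have hsub : ∀ y ∈ Z, D y ≠ 0 → φ y ≤ φ x → y ∈ K := by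
    refine fun y hyZ hy hle => ⟨hyZ, ?_, hR y hy hle⟩
    rw [Set.mem_ofPred_eq, ← Real.le_log_iff_exp_le (by positivity), div_le_iff₀ hσ]
    linarith [metric_self_nonneg y]
  have hφ : ContinuousOn φ K := continuous_metric_self.continuousOn.sub
    (continuousOn_const.mul ((hDc.norm.pow 2).continuousOn.log hK0))
  obtain ⟨y, hyK, hy⟩ := hK.exists_isMinOn ⟨x, hsub x hx hx0 le_rfl⟩ hφ
  refine ⟨y, ⟨hyK.1, fun h => hK0 y hyK (by simp [h])⟩, fun z hz => ?_⟩
  rcases le_total (φ z) (φ x) with hzx | hxz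
  · exact hy (hsub z hz.1 hz.2 hzx)
  · exact (hy (hsub x hx hx0 le_rfl)).trans hxz

variable [Fintype I]

/-- The Kempf–Ness function `‖g x‖² + σ log |∏ det g_i|²` of `x`, whose critical points on the
group determine the solutions of the moment map equation in the orbit of `x`. -/
def kempfNess (σ : ℝ) (x : Rep Q v) (g : Gauge v) : ℝ :=
  metric (act g x) (act g x) +
    σ * Real.log (‖∏ i, (g i : Matrix (Fin (v i)) (Fin (v i)) ℂ).det‖ ^ 2)

theorem kempfNess_mul (σ : ℝ) (x : Rep Q v) (g h : Gauge v) :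
    kempfNess σ x (g * h) = kempfNess σ (act h x) g +
      σ * Real.log (‖∏ i, (h i : Matrix (Fin (v i)) (Fin (v i)) ℂ).det‖ ^ 2) := by
  have hne : ∀ g : Gauge v,
      ‖∏ i, (g i : Matrix (Fin (v i)) (Fin (v i)) ℂ).det‖ ^ 2 ≠ 0 := fun g =>
    pow_ne_zero 2 (norm_ne_zero_iff.2 (left_ne_zero_of_mul_eq_one (prod_det_mul_prod_det_inv g)))
  simp only [kempfNess, act_mul, Pi.mul_apply, Units.val_mul, Matrix.det_mul,
    Finset.prod_mul_distrib, norm_mul, mul_pow, Real.log_mul (hne g) (hne h)]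
  ring

omit [Fintype E] in
theorem Costable.exists_polyFun_inv_det {o : I} {x : Rep Q v} (hx : Costable o x) :
    ∃ D ∈ polyFun Q v, ∃ Z : Set (Rep Q v), IsClosed Z ∧
      (∀ g : Gauge v, g o = 1 → act g x ∈ Z ∧
        (∏ i, (g i : Matrix (Fin (v i)) (Fin (v i)) ℂ).det) * D (act g x) = 1) ∧
      ∀ y ∈ Z, D y ≠ 0 → ∃ g : Gauge v, g o = 1 ∧ act g x = y := by
  obtain ⟨F, hF, hFx⟩ := hx.exists_reconstruction
  have hFc : ∀ i, Continuous fun y => F y i := fun i =>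
    continuous_pi fun p => continuous_pi fun q => continuous_of_mem_polyFun (hF i p q)
  have hD : (fun y => ∏ i, (F y i).det) ∈ polyFun Q v := by
    have hprod : (fun y => ∏ i, (F y i).det) = ∏ i, fun y => (F y i).det := by
      funext y
      rw [Finset.prod_apply]
    exact hprod ▸ prod_mem fun i _ => det_mem_polyFun (hF i)
  have hZ : IsClosed ({y | F y o = 1} ∩ {y | Intertwines (F y) y x}) := by
    refine (isClosed_eq (hFc o) continuous_const).inter ?_
    simp only [Intertwines, Set.ofPred_forall]
    exact isClosed_iInter fun a => isClosed_eq ((hFc _).matrix_mul (continuous_apply a))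
      (continuous_const.matrix_mul (hFc _))
  refine ⟨_, hD, _, hZ, fun g hg => ?_, ?_⟩
  · have hinv : (fun i => ((g⁻¹ i : GL (Fin (v i)) ℂ) : Matrix (Fin (v i)) (Fin (v i)) ℂ)) =
        F (act g x) := hFx _ _ (by simp [hg]) ((intertwines_inv_iff g).2 rfl)
    refine ⟨⟨by simp [← hinv, hg], ?_⟩, by simp only [← hinv, prod_det_mul_prod_det_inv]⟩
    simpa only [← hinv, Set.mem_ofPred_eq] using (intertwines_inv_iff g).2 rfl
  · rintro y ⟨hyo, hyx⟩ hy
    obtain ⟨g, hg⟩ := exists_gauge_inv_eq fun i => Finset.prod_ne_zero_iff.1 hy i (by simp)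
    exact ⟨g, inv_eq_one.1 (Units.ext ((congrFun hg o).trans hyo)),
      (intertwines_inv_iff g).1 (hg ▸ hyx)⟩

theorem Costable.exists_gauge_isMinOn {o : I} {x : Rep Q v} (hx : Costable o x) {σ : ℝ}
    (hσ : 0 < σ) : ∃ g₀ : Gauge v, g₀ o = 1 ∧ IsMinOn (kempfNess σ x) {g | g o = 1} g₀ := by
  obtain ⟨D, hD, Z, hZ, horbit, hsurj⟩ := hx.exists_polyFun_inv_det
  have hmem : ∀ g : Gauge v, g o = 1 → act g x ∈ Z ∩ {y | D y ≠ 0} := fun g hg =>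
    ⟨(horbit g hg).1, right_ne_zero_of_mul_eq_one (horbit g hg).2⟩
  have hkn : ∀ g : Gauge v, g o = 1 → kempfNess σ x g =
      metric (act g x) (act g x) - σ * Real.log (‖D (act g x)‖ ^ 2) := fun g hg => by
    rw [kempfNess, eq_inv_of_mul_eq_one_left (horbit g hg).2, norm_inv, inv_pow, Real.log_inv]
    ring
  obtain ⟨hxZ, hx0⟩ := act_one x ▸ hmem 1 rfl
  obtain ⟨y, ⟨hyZ, hy0⟩, hy⟩ := exists_isMinOn_metric_sub_log hD hZ hxZ hx0 hσ
  obtain ⟨g₀, hgo, rfl⟩ := hsurj y hyZ hy0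
  refine ⟨g₀, hgo, fun g (hg : g o = 1) => ?_⟩
  rw [Set.mem_ofPred_eq, hkn g hg, hkn g₀ hgo]
  exact hy (hmem g hg)

theorem Costable.exists_act_isMinOn {o : I} {x : Rep Q v} (hx : Costable o x) {σ : ℝ}
    (hσ : 0 < σ) : ∃ g₀ : Gauge v, IsMinOn (kempfNess σ (act g₀ x)) {g | g o = 1} 1 := by
  obtain ⟨g₀, hgo, hmin⟩ := hx.exists_gauge_isMinOn hσ
  refine ⟨g₀, fun g (hg : g o = 1) => ?_⟩
  have hle : kempfNess σ x (1 * g₀) ≤ kempfNess σ x (g * g₀) := by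
    rw [one_mul]
    exact hmin (show (g * g₀) o = 1 by rw [Pi.mul_apply, hg, hgo, mul_one])
  rw [kempfNess_mul, kempfNess_mul] at hle
  exact le_of_add_le_add_right hle

theorem isLocalMin_orbitCurve {o : I} {y : Rep Q v} {σ : ℝ}
    (hmin : IsMinOn (kempfNess σ y) {g | g o = 1} 1) {u : GaugeLie v} (hu : u o = 0) :
    IsLocalMin (fun t : ℝ => metric (orbitCurve y u t) (orbitCurve y u t) +
      σ * Real.log (‖∏ i, (1 + (t : ℂ) • u i).det‖ ^ 2)) 0 := by
  filter_upwards [Filter.eventually_all.2 fun i => eventually_det_one_add_smul_ne_zero (u i)]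
    with t ht
  let k : Gauge v := fun i => Matrix.GeneralLinearGroup.mkOfDetNeZero _ (ht i)
  have hk : ∀ i, (k i : Matrix (Fin (v i)) (Fin (v i)) ℂ) = 1 + (t : ℂ) • u i := fun _ => rfl
  have hko : k o = 1 := Units.ext (by simp [hk, hu])
  have hact : act k y = orbitCurve y u t := by
    funext a
    simp only [act, orbitCurve, hk, Matrix.coe_units_inv]
  have hle : kempfNess σ y 1 ≤ kempfNess σ y k := hmin hko
  simpa [kempfNess, act_one, orbitCurve_zero, hact, hk] using hle

variable [DecidableEq I]

theorem hasDerivAt_metric_orbitCurve (y : Rep Q v) (u : GaugeLie v) :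
    HasDerivAt (fun t => metric (orbitCurve y u t) (orbitCurve y u t))
      (2 * traceForm u (crossMoment y y)) 0 := by
  have hY : ∀ a p q, HasDerivAt (fun t => orbitCurve y u t a p q) (infAct y u a p q) 0 :=
    fun a p q => by
      convert! hasDerivAt_mul_apply
        (hasDerivAt_mul_apply (hasDerivAt_one_add_smul (u (Q.head a)))
          (B' := 0) fun p q => hasDerivAt_const (0 : ℝ) (y a p q))
        (hasDerivAt_one_add_smul_inv (u (Q.tail a))) p q using 1
      simp [infAct, sub_eq_add_neg]
  have hder := hasDerivAt_metric_self hY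
  rwa [orbitCurve_zero, show metric y (infAct y u) = metric (infAct y u) y from
    traceForm_comm _ _, metric_infAct] at hder

theorem traceForm_crossMoment_add_eq_zero {o : I} {y : Rep Q v} {σ : ℝ}
    (hmin : IsMinOn (kempfNess σ y) {g | g o = 1} 1) {u : GaugeLie v} (hu : u o = 0) :
    traceForm u (crossMoment y y + σ • 1) = 0 := by
  have hzero := (isLocalMin_orbitCurve hmin hu).hasDerivAt_eq_zero
    ((hasDerivAt_metric_orbitCurve y u).add ((hasDerivAt_log_norm_sq_prod_det u).const_mul σ))
  have hone : traceForm u (1 : GaugeLie v) = ∑ i, (u i).trace.re := by simp [traceForm_apply]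
  rw [map_add, map_smul, hone, smul_eq_mul]
  linarith

theorem crossMoment_eq_smul_one {o : I} (hv : v o = 1) {y : Rep Q v} {σ : ℝ}
    (h : ∀ u : GaugeLie v, u o = 0 → traceForm u (crossMoment y y + σ • 1) = 0) (i : I) :
    crossMoment y y i = -(σ * canonicalParam o v i : ℂ) • 1 := by
  let Z : GaugeLie v := crossMoment y y + σ • 1
  have hZ : Function.update Z o 0 = 0 := by
    refine eq_zero_of_traceForm_self ?_
    rw [← h (Function.update Z o 0) (Function.update_self ..)]
    refine Finset.sum_congr rfl fun i _ => ?_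
    rcases eq_or_ne i o with rfl | hi
    · simp
    · rw [Function.update_of_ne hi]
  have hne : ∀ i, i ≠ o → crossMoment y y i = -(σ : ℂ) • 1 := fun i hi => by
    have hZi := congrFun hZ i
    rw [Function.update_of_ne hi] at hZi
    rw [neg_smul]
    exact eq_neg_of_add_eq_zero_left hZi
  rcases eq_or_ne i o with rfl | hi
  · have htr := sum_trace_crossMoment y y
    rw [← Finset.add_sum_erase _ _ (Finset.mem_univ i),
      Finset.sum_congr rfl fun j hj => by rw [hne j (Finset.ne_of_mem_erase hj)]] at htr
    obtain ⟨d, hd⟩ : ∃ d : ℂ, crossMoment y y i = d • 1 := ⟨_, eq_det_smul_one hv _⟩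
    have hα : (canonicalParam i v i : ℂ) = -∑ j ∈ Finset.univ.erase i, (v j : ℂ) := by
      rw [canonicalParam, if_pos rfl]
      push_cast
      rfl
    simp only [hd, Matrix.trace_smul, Matrix.trace_one, Fintype.card_fin, hv, Nat.cast_one,
      smul_eq_mul, mul_one, ← Finset.mul_sum] at htr
    rw [hd, hα]
    congr 1
    linear_combination htr
  · simp [hne i hi, canonicalParam, hi]

/-- The Kempf–Ness theorem for costable representations. -/
theorem Costable.exists_crossMoment_eq {o : I} (hv : v o = 1) {x : Rep Q v} (hx : Costable o x)
    {σ : ℝ} (hσ : 0 < σ) : ∃ g : Gauge v, ∀ i,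
      crossMoment (act g x) (act g x) i = -(σ * canonicalParam o v i : ℂ) • 1 := by
  obtain ⟨g, hmin⟩ := hx.exists_act_isMinOn hσ
  exact ⟨g, crossMoment_eq_smul_one hv fun u => traceForm_crossMoment_add_eq_zero hmin⟩

end KempfNess

section Inclusion

variable {I : Type u} {v₁ v : I → ℕ}

/-- The inclusion `ℂ^{v₁ i} ⊆ ℂ^{v i}` of the first coordinates. -/
def inc (v₁ v : I → ℕ) (i : I) : Matrix (Fin (v i)) (Fin (v₁ i)) ℂ :=
  fun p q => if (p : ℕ) = q then 1 else 0

/-- The orthogonal projection of `ℂ^{v i}` onto `ℂ^{v₁ i}`. -/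
def proj₁ (v₁ v : I → ℕ) (i : I) : Matrix (Fin (v i)) (Fin (v i)) ℂ := inc v₁ v i * (inc v₁ v i)ᴴ

/-- The orthogonal projection of `ℂ^{v i}` onto the complement of `ℂ^{v₁ i}`. -/
def proj₂ (v₁ v : I → ℕ) (i : I) : Matrix (Fin (v i)) (Fin (v i)) ℂ := 1 - proj₁ v₁ v i

theorem inc_mul_apply {n : Type*} (i : I) (M : Matrix (Fin (v₁ i)) n ℂ) (p : Fin (v i)) (q : n) :
    (inc v₁ v i * M) p q = if hp : (p : ℕ) < v₁ i then M ⟨p, hp⟩ q else 0 := by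
  rw [Matrix.mul_apply]
  split_ifs with hp
  · rw [Finset.sum_eq_single ⟨p, hp⟩ (fun r _ hr => ?_) (by simp)]
    · simp [inc]
    · have hpr : (p : ℕ) ≠ r := fun h => hr (Fin.ext h.symm)
      simp [inc, hpr]
  · refine Finset.sum_eq_zero fun r _ => ?_
    have hpr : (p : ℕ) ≠ r := fun h => hp (h ▸ r.2)
    simp [inc, hpr]

theorem mul_inc_apply {m : Type*} (h : v₁ ≤ v) (i : I) (M : Matrix m (Fin (v i)) ℂ) (p : m)
    (q : Fin (v₁ i)) : (M * inc v₁ v i) p q = M p (Fin.castLE (h i) q) := by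
  rw [Matrix.mul_apply, Finset.sum_eq_single (Fin.castLE (h i) q) (fun r _ hr => ?_) (by simp)]
  · simp [inc]
  · have hrq : (r : ℕ) ≠ q := fun h => hr (Fin.ext h)
    simp [inc, hrq]

theorem conjTranspose_inc_mul_apply {n : Type*} (h : v₁ ≤ v) (i : I) (M : Matrix (Fin (v i)) n ℂ)
    (p : Fin (v₁ i)) (q : n) : ((inc v₁ v i)ᴴ * M) p q = M (Fin.castLE (h i) p) q := by
  rw [← Matrix.conjTranspose_conjTranspose M, ← Matrix.conjTranspose_mul]
  exact congrArg star (mul_inc_apply h i Mᴴ q p)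

theorem mul_conjTranspose_inc_apply {m : Type*} (i : I) (M : Matrix m (Fin (v₁ i)) ℂ) (p : m)
    (q : Fin (v i)) :
    (M * (inc v₁ v i)ᴴ) p q = if hq : (q : ℕ) < v₁ i then M p ⟨q, hq⟩ else 0 := by
  rw [← Matrix.conjTranspose_conjTranspose M, ← Matrix.conjTranspose_mul,
    Matrix.conjTranspose_apply, inc_mul_apply]
  split_ifs <;> simp

theorem conjTranspose_inc_mul_inc (h : v₁ ≤ v) (i : I) : (inc v₁ v i)ᴴ * inc v₁ v i = 1 := by
  ext p q
  rw [conjTranspose_inc_mul_apply h]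
  simp [inc, Matrix.one_apply, Fin.ext_iff]

theorem proj₁_add_proj₂ (v₁ v : I → ℕ) (i : I) : proj₁ v₁ v i + proj₂ v₁ v i = 1 :=
  add_sub_cancel _ _

theorem conjTranspose_proj₁ (v₁ v : I → ℕ) (i : I) : (proj₁ v₁ v i)ᴴ = proj₁ v₁ v i := by
  simp [proj₁]

theorem conjTranspose_proj₂ (v₁ v : I → ℕ) (i : I) : (proj₂ v₁ v i)ᴴ = proj₂ v₁ v i := by
  simp [proj₂, conjTranspose_proj₁]

theorem proj₁_mul_inc (h : v₁ ≤ v) (i : I) : proj₁ v₁ v i * inc v₁ v i = inc v₁ v i := by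
  rw [proj₁, Matrix.mul_assoc, conjTranspose_inc_mul_inc h, Matrix.mul_one]

theorem conjTranspose_inc_mul_proj₁ (h : v₁ ≤ v) (i : I) :
    (inc v₁ v i)ᴴ * proj₁ v₁ v i = (inc v₁ v i)ᴴ := by
  rw [proj₁, ← Matrix.mul_assoc, conjTranspose_inc_mul_inc h, Matrix.one_mul]

theorem proj₂_mul_inc (h : v₁ ≤ v) (i : I) : proj₂ v₁ v i * inc v₁ v i = 0 := by
  rw [proj₂, Matrix.sub_mul, proj₁_mul_inc h, Matrix.one_mul, sub_self]

theorem conjTranspose_inc_mul_proj₂ (h : v₁ ≤ v) (i : I) :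
    (inc v₁ v i)ᴴ * proj₂ v₁ v i = 0 := by
  rw [proj₂, Matrix.mul_sub, conjTranspose_inc_mul_proj₁ h, Matrix.mul_one, sub_self]

theorem proj₁_mul_self (h : v₁ ≤ v) (i : I) : proj₁ v₁ v i * proj₁ v₁ v i = proj₁ v₁ v i := by
  nth_rw 2 [proj₁]
  rw [← Matrix.mul_assoc, proj₁_mul_inc h, proj₁]

theorem proj₁_mul_proj₂ (h : v₁ ≤ v) (i : I) : proj₁ v₁ v i * proj₂ v₁ v i = 0 := by
  rw [proj₂, Matrix.mul_sub, Matrix.mul_one, proj₁_mul_self h, sub_self]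

theorem proj₂_mul_proj₁ (h : v₁ ≤ v) (i : I) : proj₂ v₁ v i * proj₁ v₁ v i = 0 := by
  rw [proj₂, Matrix.sub_mul, Matrix.one_mul, proj₁_mul_self h, sub_self]

theorem proj₂_mul_self (h : v₁ ≤ v) (i : I) : proj₂ v₁ v i * proj₂ v₁ v i = proj₂ v₁ v i := by
  nth_rw 1 [proj₂]
  rw [Matrix.sub_mul, Matrix.one_mul, proj₁_mul_proj₂ h, sub_zero]

theorem proj₂_eq_zero {i : I} (hi : v₁ i = v i) : proj₂ v₁ v i = 0 := by
  rw [proj₂, sub_eq_zero]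
  ext p q
  rw [proj₁, inc_mul_apply, dif_pos (p.2.trans_eq hi.symm)]
  simp [inc, Matrix.one_apply, Fin.ext_iff, eq_comm]

theorem trace_proj₁ (h : v₁ ≤ v) (i : I) : (proj₁ v₁ v i).trace = v₁ i := by
  rw [proj₁, Matrix.trace_mul_comm, conjTranspose_inc_mul_inc h, Matrix.trace_one,
    Fintype.card_fin]

theorem trace_proj₂ (h : v₁ ≤ v) (i : I) : (proj₂ v₁ v i).trace = v i - v₁ i := by
  rw [proj₂, Matrix.trace_sub, trace_proj₁ h, Matrix.trace_one, Fintype.card_fin]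

end Inclusion

section ExtendRestrict

variable {I : Type u} {E : Type w} {Q : Quiv I E} {v₁ v : I → ℕ}

theorem extend_eq (x₁ : Rep Q v₁) (a : E) : (extend x₁ : Rep Q v) a =
    inc v₁ v (Q.head a) * x₁ a * (inc v₁ v (Q.tail a))ᴴ := by
  ext p q
  rw [mul_conjTranspose_inc_apply, extend]
  simp only [inc_mul_apply]
  by_cases hp : (p : ℕ) < v₁ (Q.head a) <;> by_cases hq : (q : ℕ) < v₁ (Q.tail a) <;>
    simp [hp, hq]

theorem restrict_eq (h : v₁ ≤ v) (x : Rep Q v) (a : E) : restrict h x a =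
    (inc v₁ v (Q.head a))ᴴ * x a * inc v₁ v (Q.tail a) := by
  ext p q
  rw [mul_inc_apply h, conjTranspose_inc_mul_apply h]
  rfl

theorem extend_self (x : Rep Q v) : (extend x : Rep Q v) = x := by
  funext a
  ext p q
  simp [extend]

theorem restrict_extend (h : v₁ ≤ v) (x₁ : Rep Q v₁) : restrict h (extend x₁) = x₁ := by
  funext a
  ext p q
  simp [extend, restrict]

theorem restrict_add (h : v₁ ≤ v) (x y : Rep Q v) :
    restrict h (x + y) = restrict h x + restrict h y := rfl

theorem proj₁_mul_extend (h : v₁ ≤ v) (x₁ : Rep Q v₁) (a : E) :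
    proj₁ v₁ v (Q.head a) * (extend x₁ : Rep Q v) a = extend x₁ a := by
  rw [extend_eq, ← Matrix.mul_assoc, ← Matrix.mul_assoc, proj₁_mul_inc h]

theorem extend_mul_proj₁ (h : v₁ ≤ v) (x₁ : Rep Q v₁) (a : E) :
    (extend x₁ : Rep Q v) a * proj₁ v₁ v (Q.tail a) = extend x₁ a := by
  rw [extend_eq, Matrix.mul_assoc, conjTranspose_inc_mul_proj₁ h]

theorem proj₂_mul_extend (h : v₁ ≤ v) (x₁ : Rep Q v₁) (a : E) :
    proj₂ v₁ v (Q.head a) * (extend x₁ : Rep Q v) a = 0 := by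
  rw [proj₂, Matrix.sub_mul, Matrix.one_mul, proj₁_mul_extend h, sub_self]

theorem extend_mul_proj₂ (h : v₁ ≤ v) (x₁ : Rep Q v₁) (a : E) :
    (extend x₁ : Rep Q v) a * proj₂ v₁ v (Q.tail a) = 0 := by
  rw [proj₂, Matrix.mul_sub, Matrix.mul_one, extend_mul_proj₁ h, sub_self]

end ExtendRestrict

section Critical

variable {I : Type u} [DecidableEq I] {E : Type w} [Fintype E] {Q : Quiv I E} {v₁ v : I → ℕ}

theorem crossMoment_extend (h : v₁ ≤ v) (x₁ y₁ : Rep Q v₁) (i : I) :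
    crossMoment (extend x₁ : Rep Q v) (extend y₁) i =
      inc v₁ v i * crossMoment x₁ y₁ i * (inc v₁ v i)ᴴ := by
  refine commSum_eq_mul_mul (inc v₁ v) (fun i => (inc v₁ v i)ᴴ) (extend_eq x₁) (fun a => ?_)
    (fun a => ?_) (fun a => ?_) i
  · rw [extend_eq, Matrix.conjTranspose_mul, Matrix.conjTranspose_mul,
      Matrix.conjTranspose_conjTranspose, Matrix.mul_assoc]
  · rw [conjTranspose_inc_mul_inc h, Matrix.one_mul]
  · rw [conjTranspose_inc_mul_inc h, Matrix.one_mul]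

variable [Fintype I]

theorem defect_extend {o : I} (h : v₁ ≤ v) (ho : v₁ o = v o) (x₁ : Rep Q v₁) (i : I) :
    defect (canonicalParam o v) (extend x₁ : Rep Q v) i =
      inc v₁ v i * defect (canonicalParam o v) x₁ i * (inc v₁ v i)ᴴ - proj₂ v₁ v i := by
  have hone : (canonicalParam o v i : ℂ) • (1 : Matrix (Fin (v i)) (Fin (v i)) ℂ) =
      (canonicalParam o v i : ℂ) • (inc v₁ v i * (inc v₁ v i)ᴴ) + proj₂ v₁ v i := by
    have hproj : (canonicalParam o v i : ℂ) • proj₂ v₁ v i = proj₂ v₁ v i := by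
      by_cases hi : i = o
      · subst hi
        rw [proj₂_eq_zero ho, smul_zero]
      · simp [canonicalParam, hi]
    rw [← proj₁_add_proj₂ v₁ v i, smul_add, hproj, proj₁]
  rw [defect_apply, defect_apply, crossMoment_extend h, hone]
  simp only [Matrix.mul_sub, Matrix.sub_mul, Matrix.mul_smul, Matrix.smul_mul, Matrix.mul_one]
  abel

theorem infAct_extend_defect {o : I} (h : v₁ ≤ v) (ho : v₁ o = v o) (x₁ : Rep Q v₁) :
    infAct (extend x₁ : Rep Q v) (defect (canonicalParam o v) (extend x₁)) =
      extend (infAct x₁ (defect (canonicalParam o v) x₁)) := by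
  have hinc : ∀ i {m : ℕ} (N : Matrix (Fin (v₁ i)) (Fin m) ℂ),
      (inc v₁ v i)ᴴ * (inc v₁ v i * N) = N := fun i m N => by
    rw [← Matrix.mul_assoc, conjTranspose_inc_mul_inc h, Matrix.one_mul]
  funext a
  rw [infAct, defect_extend h ho, defect_extend h ho, Matrix.sub_mul, Matrix.mul_sub,
    proj₂_mul_extend h, extend_mul_proj₂ h, sub_zero, sub_zero, extend_eq, extend_eq, infAct]
  simp only [Matrix.mul_assoc, hinc, Matrix.mul_sub, Matrix.sub_mul]

theorem isCritical_extend_iff {o : I} (h : v₁ ≤ v) (ho : v₁ o = v o) (x₁ : Rep Q v₁) :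
    IsCritical (canonicalParam o v) (extend x₁ : Rep Q v) ↔
      infAct x₁ (defect (canonicalParam o v) x₁) = 0 := by
  rw [isCritical_iff, infAct_extend_defect h ho]
  constructor
  · intro hext
    rw [← restrict_extend h (infAct x₁ _), hext]
    rfl
  · intro hx₁
    funext a
    rw [hx₁, extend_eq]
    simp

omit [DecidableEq I] [Fintype E] [Fintype I] in
theorem Costable.eq_smul_one {o : I} (hv : v o = 1) {x : Rep Q v} (hx : Costable o x)
    {e : GaugeLie v} (he : infAct x e = 0) : ∃ z : ℂ, ∀ i, e i = z • 1 := by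
  have heq : e = fun i => (e o).det • 1 := by
    refine hx.eq_of_intertwines (y := x) (fun a => ?_) (fun a => ?_) (eq_det_smul_one hv (e o))
    · exact sub_eq_zero.1 (congrFun he a)
    · simp
  exact ⟨(e o).det, congrFun heq⟩

theorem sum_trace_defect {o : I} (hv : v o = 1) (A : Rep Q v) :
    ∑ i, (defect (canonicalParam o v) A i).trace = 0 := by
  have hparam : ∑ i, (canonicalParam o v i : ℂ) * v i = 0 := by
    exact_mod_cast sum_canonicalParam_mul hv
  simp only [defect_apply, Matrix.trace_sub, Matrix.trace_smul, Finset.sum_sub_distrib,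
    ← Finset.smul_sum, sum_trace_crossMoment, Matrix.trace_one, Fintype.card_fin, smul_zero,
    smul_eq_mul, hparam, sub_zero]

omit [DecidableEq I] in
theorem sum_dim_pos {o : I} (hv : v o = 1) : 0 < ∑ i, (v i : ℝ) :=
  Finset.sum_pos' (fun _ _ => Nat.cast_nonneg _) ⟨o, Finset.mem_univ o, by simp [hv]⟩

theorem Costable.exists_defect_extend_eq {o : I} (hv : v o = 1) (h : v₁ ≤ v)
    (ho : v₁ o = v o) {x₁ : Rep Q v₁} (hx : Costable o x₁)
    (hcrit : IsCritical (canonicalParam o v) (extend x₁ : Rep Q v)) :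
    ∃ c : ℝ, 0 ≤ c ∧ ∀ i, defect (canonicalParam o v) (extend x₁ : Rep Q v) i =
      (c : ℂ) • proj₁ v₁ v i - proj₂ v₁ v i := by
  obtain ⟨z, hz⟩ := hx.eq_smul_one (ho.trans hv) ((isCritical_extend_iff h ho x₁).1 hcrit)
  have hdefect : ∀ i, defect (canonicalParam o v) (extend x₁ : Rep Q v) i =
      z • proj₁ v₁ v i - proj₂ v₁ v i := fun i => by
    rw [defect_extend h ho, hz, proj₁]
    simp
  have hpos : 0 < ∑ i, (v₁ i : ℝ) := sum_dim_pos (ho.trans hv)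
  -- the trace of the defect vanishes, which determines `z`
  have htrace := sum_trace_defect hv (extend x₁ : Rep Q v)
  simp only [hdefect, Matrix.trace_sub, Matrix.trace_smul, trace_proj₁ h, trace_proj₂ h,
    Finset.sum_sub_distrib, smul_eq_mul, ← Finset.mul_sum] at htrace
  have hz : z = ((∑ i, ((v i : ℝ) - v₁ i)) / ∑ i, (v₁ i : ℝ) : ℝ) := by
    have hne : (∑ i, (v₁ i : ℂ)) ≠ 0 := by exact_mod_cast hpos.ne'
    push_cast
    rw [eq_div_iff hne, Finset.sum_sub_distrib]
    linear_combination htrace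
  refine ⟨(∑ i, ((v i : ℝ) - v₁ i)) / ∑ i, (v₁ i : ℝ), div_nonneg (Finset.sum_nonneg fun i _ =>
    sub_nonneg.2 (by exact_mod_cast h i)) hpos.le, fun i => ?_⟩
  rw [hdefect, hz]

omit [Fintype E] in
theorem canonicalParam_self {o : I} (hv : v o = 1) :
    (canonicalParam o v o : ℂ) = 1 - ∑ j, (v j : ℂ) := by
  rw [← Finset.add_sum_erase _ _ (Finset.mem_univ o), hv]
  simp [canonicalParam]

omit [Fintype E] in
/-- The difference is a constant on the vertices, that is, a central element acting trivially. -/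
theorem mul_canonicalParam_sub {o : I} (hv : v o = 1) (hv₁ : v₁ o = 1) (i : I) :
    (((∑ j, (v j : ℝ)) / ∑ j, (v₁ j : ℝ) : ℝ) : ℂ) * canonicalParam o v₁ i -
      canonicalParam o v i = (((∑ j, (v j : ℝ)) / ∑ j, (v₁ j : ℝ) : ℝ) : ℂ) - 1 := by
  by_cases hi : i = o
  · subst hi
    have hne : (∑ j, (v₁ j : ℂ)) ≠ 0 := by exact_mod_cast (sum_dim_pos hv₁).ne'
    rw [canonicalParam_self hv, canonicalParam_self hv₁]
    push_cast
    field_simp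
    ring
  · simp [canonicalParam, hi]

theorem isCritical_extend_of_crossMoment {o : I} (hv : v o = 1) (h : v₁ ≤ v)
    (ho : v₁ o = v o) {x₁ : Rep Q v₁}
    (hx : ∀ i, crossMoment x₁ x₁ i =
      -(((2 * ((∑ j, (v j : ℝ)) / ∑ j, (v₁ j : ℝ)) : ℝ) : ℂ) * canonicalParam o v₁ i) • 1) :
    IsCritical (canonicalParam o v) (extend x₁ : Rep Q v) := by
  have hdefect : ∀ i, defect (canonicalParam o v) x₁ i =
      ((((∑ j, (v j : ℝ)) / ∑ j, (v₁ j : ℝ) : ℝ) : ℂ) - 1) • 1 := fun i => by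
    rw [← mul_canonicalParam_sub hv (ho.trans hv) i, sub_smul, defect_apply, hx]
    congr 1
    ext p q
    simp only [Matrix.smul_apply, Complex.real_smul, smul_eq_mul]
    push_cast
    ring
  rw [isCritical_extend_iff h ho]
  funext a
  simp [infAct, hdefect]

end Critical

section Sandwich

variable {I : Type u} {E : Type w} {Q : Quiv I E} {v : I → ℕ}

/-- The representation `(P_{h(a)} X_a P'_{t(a)})_a`. -/
def sandwich (P P' : GaugeLie v) (X : Rep Q v) : Rep Q v := fun a =>
  P (Q.head a) * X a * P' (Q.tail a)

theorem sandwich_add (P P' : GaugeLie v) (X Y : Rep Q v) :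
    sandwich P P' (X + Y) = sandwich P P' X + sandwich P P' Y := by
  funext a
  simp only [sandwich, Pi.add_apply, Matrix.mul_add, Matrix.add_mul]

/-- `P` is a family of orthogonal projections onto a direct summand of the representation `A`,
whose orthogonal complement is a direct summand as well. -/
structure IsSummandProjection (A : Rep Q v) (P : GaugeLie v) : Prop where
  conjTranspose_eq : ∀ i, (P i)ᴴ = P i
  mul_self : ∀ i, P i * P i = P i
  comm : ∀ a, P (Q.head a) * A a = A a * P (Q.tail a)

variable {A : Rep Q v} {P P' : GaugeLie v}

theorem sandwich_sandwich (hP : IsSummandProjection A P) (hP' : IsSummandProjection A P')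
    (X : Rep Q v) : sandwich P P' (sandwich P P' X) = sandwich P P' X := by
  funext a
  simp only [sandwich, ← Matrix.mul_assoc, hP.mul_self]
  rw [Matrix.mul_assoc _ (P' _), hP'.mul_self]

theorem sandwich_infAct (hP : IsSummandProjection A P) (hP' : IsSummandProjection A P')
    (u : GaugeLie v) : sandwich P P' (infAct A u) = infAct A fun i => P i * u i * P' i := by
  funext a
  simp only [sandwich, infAct, Matrix.mul_sub, Matrix.sub_mul, Matrix.mul_assoc, hP'.comm]
  simp only [← Matrix.mul_assoc, hP.comm]

variable [Fintype E]

theorem metric_sandwich (hP : IsSummandProjection A P) (hP' : IsSummandProjection A P')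
    (X Y : Rep Q v) : metric (sandwich P P' X) Y = metric X (sandwich P P' Y) := by
  refine Finset.sum_congr rfl fun a _ => ?_
  simp only [sandwich, Matrix.conjTranspose_mul, hP.conjTranspose_eq, hP'.conjTranspose_eq]
  rw [Matrix.mul_assoc, Matrix.mul_assoc, Matrix.trace_mul_comm]
  simp only [Matrix.mul_assoc]

theorem metric_infAct_sandwich (hP : IsSummandProjection A P) (hP' : IsSummandProjection A P')
    {δ : Rep Q v} (hδ : ∀ u, metric (infAct A u) δ = 0) (u : GaugeLie v) :
    metric (infAct A u) (sandwich P P' δ) = 0 := by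
  rw [← metric_sandwich hP hP', sandwich_infAct hP hP', hδ]

variable [DecidableEq I]

/-- A projection onto a direct summand of `A` on which the defect is the scalar `s`. -/
structure IsEigenprojection (α : I → ℤ) (A : Rep Q v) (P : GaugeLie v) (s : ℝ) : Prop
    extends IsSummandProjection A P where
  defect_mul : ∀ i, defect α A i * P i = (s : ℂ) • P i

variable {α : I → ℤ} {s t : ℝ}

theorem IsEigenprojection.mul_defect (hP : IsEigenprojection α A P s) (i : I) :
    P i * defect α A i = (s : ℂ) • P i := by
  rw [← hP.conjTranspose_eq i, ← conjTranspose_defect, ← Matrix.conjTranspose_mul,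
    hP.defect_mul, Matrix.conjTranspose_smul]
  simp

theorem infAct_sandwich_defect (hP : IsEigenprojection α A P s)
    (hP' : IsEigenprojection α A P' t) (X : Rep Q v) :
    infAct (sandwich P P' X) (defect α A) = (s - t) • sandwich P P' X := by
  funext a
  simp only [infAct, sandwich, Pi.smul_apply, ← Matrix.mul_assoc, hP.defect_mul]
  rw [Matrix.mul_assoc _ (P' _), hP'.mul_defect, Matrix.smul_mul, Matrix.smul_mul, Matrix.mul_smul,
    Complex.coe_smul, Complex.coe_smul, sub_smul]

variable [Fintype I]

theorem hessian_sandwich (hP : IsEigenprojection α A P s) (hP' : IsEigenprojection α A P' t)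
    {δ : Rep Q v} (hδ : ∀ u, metric (infAct A u) δ = 0) (Y : Rep Q v) :
    hessian α A (sandwich P P' δ) Y = 2 * (t - s) * metric (sandwich P P' δ) Y := by
  have hsmul : metric ((s - t) • sandwich P P' δ) Y = (s - t) * metric (sandwich P P' δ) Y :=
    LinearMap.map_smul₂ traceForm (s - t) (sandwich P P' δ) Y
  rw [hessian_of_orthogonal α (metric_infAct_sandwich hP.1 hP'.1 hδ),
    infAct_sandwich_defect hP hP', hsmul]
  ring

theorem sandwich_eq_zero_of_mem_negSpace (hP : IsEigenprojection α A P s)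
    (hP' : IsEigenprojection α A P' t) (hst : s ≤ t) {δ : Rep Q v}
    (hδ : ∀ u, metric (infAct A u) δ = 0) (hneg : δ ∈ negSpace α A) : sandwich P P' δ = 0 := by
  have hzero : metric δ (sandwich P P' δ) = 0 :=
    metric_eq_zero_of_mem_negSpace α (l := 2 * (t - s)) (by linarith)
      (hessian_sandwich hP hP' hδ) hneg
  refine eq_zero_of_traceForm_self (?_ : metric _ _ = 0)
  rwa [metric_sandwich hP.1 hP'.1, sandwich_sandwich hP.1 hP'.1]

end Sandwich

section NegSlice

variable {I : Type u} {E : Type w} {Q : Quiv I E} {v₁ v : I → ℕ}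

theorem isSummandProjection_proj₁ (h : v₁ ≤ v) (x₁ : Rep Q v₁) :
    IsSummandProjection (extend x₁ : Rep Q v) (proj₁ v₁ v) where
  conjTranspose_eq := conjTranspose_proj₁ v₁ v
  mul_self := proj₁_mul_self h
  comm a := (proj₁_mul_extend h x₁ a).trans (extend_mul_proj₁ h x₁ a).symm

theorem isSummandProjection_proj₂ (h : v₁ ≤ v) (x₁ : Rep Q v₁) :
    IsSummandProjection (extend x₁ : Rep Q v) (proj₂ v₁ v) where
  conjTranspose_eq := conjTranspose_proj₂ v₁ v
  mul_self := proj₂_mul_self h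
  comm a := (proj₂_mul_extend h x₁ a).trans (extend_mul_proj₂ h x₁ a).symm

variable [DecidableEq I] [Fintype E]

theorem isEigenprojection_proj₁ (h : v₁ ≤ v) {α : I → ℤ} {x₁ : Rep Q v₁} {c : ℝ}
    (hd : ∀ i, defect α (extend x₁ : Rep Q v) i = (c : ℂ) • proj₁ v₁ v i - proj₂ v₁ v i) :
    IsEigenprojection α (extend x₁ : Rep Q v) (proj₁ v₁ v) c where
  toIsSummandProjection := isSummandProjection_proj₁ h x₁
  defect_mul i := by simp [hd, Matrix.sub_mul, proj₁_mul_self h, proj₂_mul_proj₁ h]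

theorem isEigenprojection_proj₂ (h : v₁ ≤ v) {α : I → ℤ} {x₁ : Rep Q v₁} {c : ℝ}
    (hd : ∀ i, defect α (extend x₁ : Rep Q v) i = (c : ℂ) • proj₁ v₁ v i - proj₂ v₁ v i) :
    IsEigenprojection α (extend x₁ : Rep Q v) (proj₂ v₁ v) (-1) where
  toIsSummandProjection := isSummandProjection_proj₂ h x₁
  defect_mul i := by simp [hd, Matrix.sub_mul, proj₂_mul_self h, proj₁_mul_proj₂ h]

variable [Fintype I]

/-- Elements of the negative slice at `(x₁, 0)` are homomorphisms from the second summand to the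
first one: on the other three blocks the Hessian is nonnegative. -/
theorem sandwich_eq_self_of_mem_negSpace (h : v₁ ≤ v) {α : I → ℤ} {x₁ : Rep Q v₁} {c : ℝ}
    (hc : 0 ≤ c)
    (hd : ∀ i, defect α (extend x₁ : Rep Q v) i = (c : ℂ) • proj₁ v₁ v i - proj₂ v₁ v i)
    {δ : Rep Q v} (hδ : ∀ u, metric (infAct (extend x₁) u) δ = 0)
    (hneg : δ ∈ negSpace α (extend x₁)) : sandwich (proj₁ v₁ v) (proj₂ v₁ v) δ = δ := by
  have hP₁ := isEigenprojection_proj₁ h hd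
  have hP₂ := isEigenprojection_proj₂ h hd
  funext a
  have h₁₁ := congrFun (sandwich_eq_zero_of_mem_negSpace hP₁ hP₁ le_rfl hδ hneg) a
  have h₂₁ := congrFun (sandwich_eq_zero_of_mem_negSpace hP₂ hP₁ (by linarith) hδ hneg) a
  have h₂₂ := congrFun (sandwich_eq_zero_of_mem_negSpace hP₂ hP₂ le_rfl hδ hneg) a
  simp only [sandwich, Pi.zero_apply] at h₁₁ h₂₁ h₂₂ ⊢
  calc proj₁ v₁ v (Q.head a) * δ a * proj₂ v₁ v (Q.tail a)
      = proj₁ v₁ v (Q.head a) * δ a * proj₁ v₁ v (Q.tail a) +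
        proj₁ v₁ v (Q.head a) * δ a * proj₂ v₁ v (Q.tail a) +
        (proj₂ v₁ v (Q.head a) * δ a * proj₁ v₁ v (Q.tail a) +
        proj₂ v₁ v (Q.head a) * δ a * proj₂ v₁ v (Q.tail a)) := by
        rw [h₁₁, h₂₁, h₂₂, zero_add, add_zero, add_zero]
    _ = (proj₁ v₁ v (Q.head a) + proj₂ v₁ v (Q.head a)) * δ a *
        (proj₁ v₁ v (Q.tail a) + proj₂ v₁ v (Q.tail a)) := by
        simp only [Matrix.add_mul, Matrix.mul_add]
        abel
    _ = δ a := by rw [proj₁_add_proj₂, proj₁_add_proj₂, Matrix.one_mul, Matrix.mul_one]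

theorem sandwich_mem_negSpace (h : v₁ ≤ v) {α : I → ℤ} {x₁ : Rep Q v₁} {c : ℝ} (hc : 0 ≤ c)
    (hd : ∀ i, defect α (extend x₁ : Rep Q v) i = (c : ℂ) • proj₁ v₁ v i - proj₂ v₁ v i)
    {δ : Rep Q v} (hδ : ∀ u, metric (infAct (extend x₁) u) δ = 0) :
    sandwich (proj₁ v₁ v) (proj₂ v₁ v) δ ∈ negSpace α (extend x₁) :=
  mem_negSpace_of_eigenvector α (l := 2 * (-1 - c)) (by linarith)
    (hessian_sandwich (isEigenprojection_proj₁ h hd) (isEigenprojection_proj₂ h hd) hδ)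

end NegSlice

section OrthogonalCorrection

variable {I : Type u} {E : Type w} {Q : Quiv I E} {v : I → ℕ}

/-- The infinitesimal action at `A`, as a linear map. -/
def infActLinear (A : Rep Q v) : GaugeLie v →ₗ[ℝ] Rep Q v where
  toFun := infAct A
  map_add' u w := by
    funext a
    simp only [infAct, Pi.add_apply, Matrix.add_mul, Matrix.mul_add, add_sub_add_comm]
  map_smul' t u := by
    funext a
    simp [infAct, smul_sub]

theorem exists_orthogonal_correction [Fintype E] (A δ : Rep Q v) :
    ∃ u : GaugeLie v, ∀ w : GaugeLie v, metric (infAct A w) (δ + infAct A u) = 0 := by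
  obtain ⟨_, ⟨u, rfl⟩, z, hz, rfl⟩ := Submodule.mem_sup.1
    ((isCompl_orthogonal_traceForm (LinearMap.range (infActLinear A))).sup_eq_top ▸
      Submodule.mem_top : δ ∈ _)
  refine ⟨-u, fun w => ?_⟩
  have hcorr : infActLinear A u + z + infAct A (-u) = z := by
    rw [show infAct A (-u) = -infActLinear A u from map_neg (infActLinear A) u]
    abel
  rw [hcorr]
  exact hz _ ⟨w, rfl⟩

end OrthogonalCorrection

section LandsIn

variable {I : Type u} {E : Type w} {Q : Quiv I E} {v₁ v : I → ℕ}

/-- All the maps `x_a` take values in the subspaces `ℂ^{v₁ i} ⊆ ℂ^{v i}`. -/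
def LandsIn (v₁ : I → ℕ) (x : Rep Q v) : Prop := ∀ a, proj₂ v₁ v (Q.head a) * x a = 0

theorem proj₁_mul_of_proj₂_mul {i : I} {n : Type*} {M : Matrix (Fin (v i)) n ℂ}
    (hM : proj₂ v₁ v i * M = 0) : proj₁ v₁ v i * M = M := by
  rw [← add_zero (proj₁ v₁ v i * M), ← hM, ← Matrix.add_mul, proj₁_add_proj₂, Matrix.one_mul]

theorem LandsIn.mul_inc (h : v₁ ≤ v) {x : Rep Q v} (hx : LandsIn v₁ x) (a : E) :
    x a * inc v₁ v (Q.tail a) = inc v₁ v (Q.head a) * restrict h x a := by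
  rw [restrict_eq, ← Matrix.mul_assoc, ← Matrix.mul_assoc, ← proj₁, proj₁_mul_of_proj₂_mul (hx a)]

theorem LandsIn.extend_restrict (h : v₁ ≤ v) {x : Rep Q v} (hx : LandsIn v₁ x) (a : E) :
    (extend (restrict h x) : Rep Q v) a = x a * proj₁ v₁ v (Q.tail a) := by
  rw [extend_eq, ← hx.mul_inc h, Matrix.mul_assoc, proj₁]

theorem inc_mulVec_injective (h : v₁ ≤ v) (i : I) :
    Function.Injective (inc v₁ v i).mulVecLin := fun w w' hw => by
  have hleft := congrArg (fun z => (inc v₁ v i)ᴴ *ᵥ z) hw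
  simpa [Matrix.mulVec_mulVec, conjTranspose_inc_mul_inc h] using hleft

theorem LandsIn.costable_restrict {o : I} (h : v₁ ≤ v) {x : Rep Q v} (hinv : LandsIn v₁ x)
    (hx : Costable o x) : Costable o (restrict h x) := by
  intro W hW ho i
  have hbot := hx (fun i => (W i).map (inc v₁ v i).mulVecLin) ?_ (by simp [ho]) i
  · exact Submodule.map_injective_of_injective (inc_mulVec_injective h i)
      (hbot.trans (Submodule.map_bot _).symm)
  · rintro a _ ⟨w, hw, rfl⟩
    refine ⟨_, hW a w hw, ?_⟩
    simp only [Matrix.mulVecLin_apply, Matrix.mulVec_mulVec, hinv.mul_inc h]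

theorem compression_mul_compression (h : v₁ ≤ v) {i : I} {M N : Matrix (Fin (v i)) (Fin (v i)) ℂ}
    (hN : proj₂ v₁ v i * (N * inc v₁ v i) = 0) (hMN : M * N = 1) :
    (inc v₁ v i)ᴴ * M * inc v₁ v i * ((inc v₁ v i)ᴴ * N * inc v₁ v i) = 1 := by
  calc (inc v₁ v i)ᴴ * M * inc v₁ v i * ((inc v₁ v i)ᴴ * N * inc v₁ v i)
      = (inc v₁ v i)ᴴ * M * (proj₁ v₁ v i * (N * inc v₁ v i)) := by
        simp only [proj₁, Matrix.mul_assoc]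
    _ = (inc v₁ v i)ᴴ * (M * N) * inc v₁ v i := by
        rw [proj₁_mul_of_proj₂_mul hN]
        simp only [Matrix.mul_assoc]
    _ = 1 := by rw [hMN, Matrix.mul_one, conjTranspose_inc_mul_inc h]

/-- The element of `G_{v₁}` by which an element of `G_v` preserving the subspaces `ℂ^{v₁ i}` acts
on them. -/
def compressGauge (h : v₁ ≤ v) (g : Gauge v)
    (hg : ∀ i, proj₂ v₁ v i * ((g i : Matrix (Fin (v i)) (Fin (v i)) ℂ) * inc v₁ v i) = 0)
    (hg' : ∀ i, proj₂ v₁ v i *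
      ((((g i)⁻¹ : GL (Fin (v i)) ℂ) : Matrix (Fin (v i)) (Fin (v i)) ℂ) * inc v₁ v i) = 0) :
    Gauge v₁ := fun i =>
  ⟨(inc v₁ v i)ᴴ * (g i : Matrix (Fin (v i)) (Fin (v i)) ℂ) * inc v₁ v i,
    (inc v₁ v i)ᴴ * (((g i)⁻¹ : GL (Fin (v i)) ℂ) : Matrix (Fin (v i)) (Fin (v i)) ℂ) *
      inc v₁ v i,
    compression_mul_compression h (hg' i) (g i).val_inv,
    compression_mul_compression h (hg i) (g i).inv_val⟩

theorem LandsIn.act_compressGauge (h : v₁ ≤ v) {x : Rep Q v} (hx : LandsIn v₁ x) {g : Gauge v}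
    (hg : ∀ i, proj₂ v₁ v i * ((g i : Matrix (Fin (v i)) (Fin (v i)) ℂ) * inc v₁ v i) = 0)
    (hg' : ∀ i, proj₂ v₁ v i *
      ((((g i)⁻¹ : GL (Fin (v i)) ℂ) : Matrix (Fin (v i)) (Fin (v i)) ℂ) * inc v₁ v i) = 0) :
    act (compressGauge h g hg hg') (restrict h x) = restrict h (act g x) := by
  funext a
  let j := inc v₁ v
  let G : GaugeLie v := fun i => (g i).val
  let G' : GaugeLie v := fun i => ((g i)⁻¹ : GL (Fin (v i)) ℂ).val
  calc (j (Q.head a))ᴴ * G (Q.head a) * j (Q.head a) * restrict h x a *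
        ((j (Q.tail a))ᴴ * G' (Q.tail a) * j (Q.tail a))
      = (j (Q.head a))ᴴ * G (Q.head a) * (j (Q.head a) * restrict h x a) *
        ((j (Q.tail a))ᴴ * G' (Q.tail a) * j (Q.tail a)) := by simp only [Matrix.mul_assoc]
    _ = (j (Q.head a))ᴴ * G (Q.head a) * x a *
        (proj₁ v₁ v (Q.tail a) * (G' (Q.tail a) * j (Q.tail a))) := by
        rw [← hx.mul_inc h]
        simp only [j, proj₁, Matrix.mul_assoc]
    _ = (j (Q.head a))ᴴ * (G (Q.head a) * x a * G' (Q.tail a)) * j (Q.tail a) := by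
        rw [proj₁_mul_of_proj₂_mul (hg' _)]
        simp only [j, G', Matrix.mul_assoc]
    _ = restrict h (act g x) a := by rw [restrict_eq, act]

end LandsIn

section ExtendGauge

variable {I : Type u} {E : Type w} {Q : Quiv I E} {v₁ v : I → ℕ}

theorem extension_mul_extension (h : v₁ ≤ v) {i : I} {M N : Matrix (Fin (v₁ i)) (Fin (v₁ i)) ℂ}
    (hMN : M * N = 1) : (inc v₁ v i * M * (inc v₁ v i)ᴴ + proj₂ v₁ v i) *
      (inc v₁ v i * N * (inc v₁ v i)ᴴ + proj₂ v₁ v i) = 1 := by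
  have hdiag : inc v₁ v i * M * (inc v₁ v i)ᴴ * (inc v₁ v i * N * (inc v₁ v i)ᴴ) =
      proj₁ v₁ v i := by
    calc inc v₁ v i * M * (inc v₁ v i)ᴴ * (inc v₁ v i * N * (inc v₁ v i)ᴴ)
        = inc v₁ v i * (M * ((inc v₁ v i)ᴴ * inc v₁ v i) * N) * (inc v₁ v i)ᴴ := by
          simp only [Matrix.mul_assoc]
      _ = _ := by rw [conjTranspose_inc_mul_inc h, Matrix.mul_one, hMN, Matrix.mul_one, proj₁]
  have hleft : inc v₁ v i * M * (inc v₁ v i)ᴴ * proj₂ v₁ v i = 0 := by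
    rw [Matrix.mul_assoc, conjTranspose_inc_mul_proj₂ h, Matrix.mul_zero]
  have hright : proj₂ v₁ v i * (inc v₁ v i * N * (inc v₁ v i)ᴴ) = 0 := by
    rw [← Matrix.mul_assoc, ← Matrix.mul_assoc, proj₂_mul_inc h, Matrix.zero_mul, Matrix.zero_mul]
  rw [Matrix.mul_add, Matrix.add_mul, Matrix.add_mul, hdiag, hleft, hright, proj₂_mul_self h,
    add_zero, zero_add, proj₁_add_proj₂]

/-- The element of `G_v` that acts by `g₁` on the first summand and trivially on the second one. -/
def extendGauge (h : v₁ ≤ v) (g₁ : Gauge v₁) : Gauge v := fun i =>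
  ⟨_, _, extension_mul_extension h (g₁ i).mul_inv, extension_mul_extension h (g₁ i).inv_mul⟩

theorem coe_extendGauge (h : v₁ ≤ v) (g₁ : Gauge v₁) (i : I) :
    (extendGauge h g₁ i : Matrix (Fin (v i)) (Fin (v i)) ℂ) =
      inc v₁ v i * (g₁ i : Matrix (Fin (v₁ i)) (Fin (v₁ i)) ℂ) * (inc v₁ v i)ᴴ + proj₂ v₁ v i := rfl

theorem coe_extendGauge_inv (h : v₁ ≤ v) (g₁ : Gauge v₁) (i : I) :
    (((extendGauge h g₁ i)⁻¹ : GL (Fin (v i)) ℂ) : Matrix (Fin (v i)) (Fin (v i)) ℂ) =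
      inc v₁ v i * (((g₁ i)⁻¹ : GL (Fin (v₁ i)) ℂ) : Matrix (Fin (v₁ i)) (Fin (v₁ i)) ℂ) *
        (inc v₁ v i)ᴴ + proj₂ v₁ v i := rfl

theorem LandsIn.act_extendGauge (h : v₁ ≤ v) (g₁ : Gauge v₁) {x : Rep Q v} (hx : LandsIn v₁ x) :
    LandsIn v₁ (act (extendGauge h g₁) x) := fun a => by
  rw [act, coe_extendGauge, ← Matrix.mul_assoc, ← Matrix.mul_assoc, Matrix.mul_add,
    ← Matrix.mul_assoc, ← Matrix.mul_assoc, proj₂_mul_inc h, proj₂_mul_self h, Matrix.zero_mul,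
    Matrix.zero_mul, zero_add, hx, Matrix.zero_mul]

theorem conjTranspose_inc_mul_extendGauge (h : v₁ ≤ v) (g₁ : Gauge v₁) (i : I) :
    (inc v₁ v i)ᴴ * (extendGauge h g₁ i : Matrix (Fin (v i)) (Fin (v i)) ℂ) =
      (g₁ i : Matrix (Fin (v₁ i)) (Fin (v₁ i)) ℂ) * (inc v₁ v i)ᴴ := by
  rw [coe_extendGauge, Matrix.mul_add, conjTranspose_inc_mul_proj₂ h, add_zero,
    ← Matrix.mul_assoc, ← Matrix.mul_assoc, conjTranspose_inc_mul_inc h, Matrix.one_mul]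

theorem extendGauge_inv_mul_inc (h : v₁ ≤ v) (g₁ : Gauge v₁) (i : I) :
    (((extendGauge h g₁ i)⁻¹ : GL (Fin (v i)) ℂ) : Matrix (Fin (v i)) (Fin (v i)) ℂ) *
      inc v₁ v i =
        inc v₁ v i * (((g₁ i)⁻¹ : GL (Fin (v₁ i)) ℂ) : Matrix (Fin (v₁ i)) (Fin (v₁ i)) ℂ) := by
  rw [coe_extendGauge_inv, Matrix.add_mul, proj₂_mul_inc h, add_zero, Matrix.mul_assoc,
    conjTranspose_inc_mul_inc h, Matrix.mul_one]

theorem restrict_act_extendGauge (h : v₁ ≤ v) (g₁ : Gauge v₁) (x : Rep Q v) :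
    restrict h (act (extendGauge h g₁) x) = act g₁ (restrict h x) := by
  funext a
  rw [restrict_eq, act, act, restrict_eq, Matrix.mul_assoc, Matrix.mul_assoc _ _ (inc v₁ v _),
    extendGauge_inv_mul_inc]
  simp only [← Matrix.mul_assoc, conjTranspose_inc_mul_extendGauge]

end ExtendGauge

section Unipotent

variable {I : Type u} {E : Type w} {Q : Quiv I E} {v₁ v : I → ℕ}

theorem LandsIn.exists_act_eq_add_infAct (h : v₁ ≤ v) {x : Rep Q v} (hx : LandsIn v₁ x)
    (u : GaugeLie v) : ∃ g : Gauge v, act g x =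
      x + infAct (extend (restrict h x)) fun i => proj₁ v₁ v i * u i * proj₂ v₁ v i := by
  let n : GaugeLie v := fun i => proj₁ v₁ v i * u i * proj₂ v₁ v i
  have hn : ∀ i {m : ℕ} (N : Matrix (Fin (v i)) (Fin m) ℂ), proj₂ v₁ v i * N = 0 → n i * N = 0 :=
    fun i m N hN => by simp only [n, Matrix.mul_assoc, hN, Matrix.mul_zero]
  have hnn : ∀ i, n i * n i = 0 := fun i => hn i _ (by
    simp only [n, ← Matrix.mul_assoc, proj₂_mul_proj₁ h, Matrix.zero_mul])
  have hp : ∀ i, proj₁ v₁ v i * n i = n i := fun i => by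
    simp only [n, ← Matrix.mul_assoc, proj₁_mul_self h]
  refine ⟨fun i => ⟨1 + n i, 1 - n i, by simp [Matrix.mul_sub, Matrix.add_mul, hnn],
    by simp [Matrix.mul_add, Matrix.sub_mul, hnn]⟩, funext fun a => ?_⟩
  calc (1 + n (Q.head a)) * x a * (1 - n (Q.tail a)) = x a - x a * n (Q.tail a) := by
        rw [Matrix.add_mul, hn _ _ (hx a), Matrix.one_mul, add_zero, Matrix.mul_sub,
          Matrix.mul_one]
    _ = x a + (n (Q.head a) * (extend (restrict h x) : Rep Q v) a -
          (extend (restrict h x) : Rep Q v) a * n (Q.tail a)) := by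
        rw [hn _ _ (proj₂_mul_extend h _ a), hx.extend_restrict h, Matrix.mul_assoc, hp, zero_sub,
          sub_eq_add_neg]

theorem LandsIn.sandwich_sub_extend_restrict (h : v₁ ≤ v) {x : Rep Q v} (hx : LandsIn v₁ x) :
    sandwich (proj₁ v₁ v) (proj₂ v₁ v) (x - extend (restrict h x)) =
      x - extend (restrict h x) := by
  funext a
  rw [sandwich, Pi.sub_apply, Matrix.mul_sub, proj₁_mul_of_proj₂_mul (hx a), proj₁_mul_extend h,
    Matrix.sub_mul, extend_mul_proj₂ h, sub_zero, hx.extend_restrict h, proj₂, Matrix.mul_sub,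
    Matrix.mul_one]

/-- Up to the unipotent group `1 + Hom(V₂, V₁)`, an extension of the trivial representation `V₂`
by `x₁` differs from `(x₁, 0)` by an element of the slice. -/
theorem LandsIn.exists_gauge_orthogonal [Fintype E] (h : v₁ ≤ v) {x : Rep Q v}
    (hx : LandsIn v₁ x) : ∃ (g : Gauge v) (δ : Rep Q v),
      act g x = extend (restrict h x) + δ ∧ sandwich (proj₁ v₁ v) (proj₂ v₁ v) δ = δ ∧
        ∀ u, metric (infAct (extend (restrict h x)) u) δ = 0 := by
  have hP₁ := isSummandProjection_proj₁ h (restrict h x)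
  have hP₂ := isSummandProjection_proj₂ h (restrict h x)
  obtain ⟨u, hu⟩ := exists_orthogonal_correction (extend (restrict h x)) (x - extend (restrict h x))
  obtain ⟨g, hg⟩ := hx.exists_act_eq_add_infAct h u
  refine ⟨g, sandwich (proj₁ v₁ v) (proj₂ v₁ v) _, ?_, sandwich_sandwich hP₁ hP₂ _,
    metric_infAct_sandwich hP₁ hP₂ hu⟩
  rw [hg, sandwich_add, hx.sandwich_sub_extend_restrict h, sandwich_infAct hP₁ hP₂]
  abel

end Unipotent

section ComplexMomentMap

variable {I : Type u} [Fintype I] [DecidableEq I] {E : Type w} [Fintype E] {Q : Quiv I E}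
  {v₁ v : I → ℕ}

theorem complexMomentMap_of_eq_mul_mul (G : ∀ i, Matrix (Fin (v i)) (Fin (v₁ i)) ℂ)
    (G' : ∀ i, Matrix (Fin (v₁ i)) (Fin (v i)) ℂ) {x : Rep Q.double v₁} {y : Rep Q.double v}
    (hy : ∀ e, y e = G (Q.double.head e) * x e * G' (Q.double.tail e))
    (hG : ∀ e, G' (Q.double.head e) * G (Q.double.head e) * x e = x e)
    (hx : complexMomentMap x = 0) : complexMomentMap y = 0 := by
  rw [complexMomentMap_eq_zero_iff] at hx ⊢
  funext i
  refine (commSum_eq_mul_mul G G' (A := forwardPart x) (B := backwardPart x)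
    (A' := forwardPart y) (B' := backwardPart y) (fun a => hy (Sum.inl a))
    (fun a => hy (Sum.inr a)) (fun a => hG (Sum.inl a)) (fun a => hG (Sum.inr a)) i).trans ?_
  rw [hx, Pi.zero_apply, Matrix.mul_zero, Matrix.zero_mul, Pi.zero_apply]

theorem complexMomentMap_act {x : Rep Q.double v} (hx : complexMomentMap x = 0) (g : Gauge v) :
    complexMomentMap (act g x) = 0 :=
  complexMomentMap_of_eq_mul_mul (fun i => (g i).val) (fun i => (g i).inv) (fun _ => rfl)
    (fun e => by rw [Units.inv_val, Matrix.one_mul]) hx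

theorem complexMomentMap_extend (h : v₁ ≤ v) {x₁ : Rep Q.double v₁}
    (hx : complexMomentMap x₁ = 0) : complexMomentMap (extend x₁ : Rep Q.double v) = 0 :=
  complexMomentMap_of_eq_mul_mul (inc v₁ v) (fun i => (inc v₁ v i)ᴴ) (extend_eq x₁)
    (fun e => by rw [conjTranspose_inc_mul_inc h, Matrix.one_mul]) hx

theorem LandsIn.complexMomentMap_restrict (h : v₁ ≤ v) {x : Rep Q.double v} (hinv : LandsIn v₁ x)
    (hx : complexMomentMap x = 0) : complexMomentMap (restrict h x) = 0 :=
  complexMomentMap_of_eq_mul_mul (fun i => (inc v₁ v i)ᴴ) (inc v₁ v) (restrict_eq h x)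
    (fun e => proj₁_mul_of_proj₂_mul (hinv e)) hx

end ComplexMomentMap

section OrbitClasses

variable {I : Type u} {E : Type w} {Q : Quiv I E} {v : I → ℕ}

theorem toOrbit_eq_iff {x y : Rep Q v} : toOrbit x = toOrbit y ↔ ∃ g : Gauge v, act g x = y :=
  Quotient.eq (r := orbitSetoid Q v)

theorem toOrbit_act (g : Gauge v) (x : Rep Q v) : toOrbit (act g x) = toOrbit x :=
  (toOrbit_eq_iff.2 ⟨g, rfl⟩).symm

variable [Fintype I] [DecidableEq I] [Fintype E]

theorem toOrbit_mem_quiverVariety_iff {o : I} (hv : v o = 1) {x : Rep Q.double v} :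
    toOrbit x ∈ quiverVariety Q o v ↔ complexMomentMap x = 0 ∧ Costable o x := by
  refine ⟨?_, fun h => ⟨x, rfl, h.1, (isStable_iff_costable hv).2 h.2⟩⟩
  rintro ⟨y, hyx, hy, hst⟩
  obtain ⟨g, rfl⟩ := toOrbit_eq_iff.1 hyx
  exact ⟨complexMomentMap_act hy g, ((isStable_iff_costable hv).1 hst).gauge g⟩

end OrbitClasses

section BlockPerturbation

variable {I : Type u} {E : Type w} {Q : Quiv I E} {v₁ v : I → ℕ}

theorem landsIn_extend_add (h : v₁ ≤ v) (x₁ : Rep Q v₁) {δ : Rep Q v}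
    (hδ : sandwich (proj₁ v₁ v) (proj₂ v₁ v) δ = δ) : LandsIn v₁ (extend x₁ + δ) := fun a => by
  rw [← hδ, Pi.add_apply, Matrix.mul_add, proj₂_mul_extend h, sandwich, ← Matrix.mul_assoc,
    ← Matrix.mul_assoc, proj₂_mul_proj₁ h, Matrix.zero_mul, Matrix.zero_mul, add_zero]

theorem restrict_extend_add (h : v₁ ≤ v) (x₁ : Rep Q v₁) {δ : Rep Q v}
    (hδ : sandwich (proj₁ v₁ v) (proj₂ v₁ v) δ = δ) : restrict h (extend x₁ + δ) = x₁ := by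
  have hzero : restrict h δ = 0 := funext fun a => by
    rw [← hδ, restrict_eq, sandwich, Matrix.mul_assoc, Matrix.mul_assoc _ (proj₂ _ _ _),
      proj₂_mul_inc h, Matrix.mul_zero, Matrix.mul_zero, Pi.zero_apply]
  rw [restrict_add, restrict_extend, hzero, add_zero]

end BlockPerturbation

section FlowLines

variable {I : Type u} [Fintype I] [DecidableEq I] {E : Type w} [Fintype E]

theorem Costable.exists_isCritical_extend {Q : Quiv I E} {v₁ v : I → ℕ} {o : I} (hv : v o = 1)
    (h : v₁ ≤ v) (ho : v₁ o = v o) {x₁ : Rep Q v₁} (hx : Costable o x₁) :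
    ∃ g₁ : Gauge v₁, IsCritical (canonicalParam o v) (extend (act g₁ x₁) : Rep Q v) := by
  have hv₁ := ho.trans hv
  obtain ⟨g₁, hg₁⟩ := hx.exists_crossMoment_eq hv₁
    (mul_pos two_pos (div_pos (sum_dim_pos hv) (sum_dim_pos hv₁)))
  exact ⟨g₁, isCritical_extend_of_crossMoment hv h ho hg₁⟩

variable {Q : Quiv I E} {v₁ v : I → ℕ} {o : I}

theorem extend_mem_criticalSet_iff (hv₁ : v₁ o = 1) (h : v₁ ≤ v) {x₁ : Rep Q.double v₁} :
    extend x₁ ∈ criticalSet Q o v₁ v ↔ complexMomentMap (extend x₁ : Rep Q.double v) = 0 ∧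
      IsCritical (canonicalParam o v) (extend x₁ : Rep Q.double v) ∧ Costable o x₁ := by
  refine and_congr_right fun _ => and_congr_right fun _ => ⟨?_, fun hx => ⟨x₁, rfl, ?_⟩⟩
  · rintro ⟨y₁, hy, hst⟩
    have hxy : x₁ = y₁ := by simpa only [restrict_extend] using congrArg (restrict h) hy
    exact (isStable_iff_costable hv₁).1 (hxy ▸ hst)
  · exact (isStable_iff_costable hv₁).2 hx

theorem mem_criticalSet_self_iff (hv : v o = 1) {x : Rep Q.double v} :
    x ∈ criticalSet Q o v v ↔
      complexMomentMap x = 0 ∧ IsCritical (canonicalParam o v) x ∧ Costable o x := by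
  simpa only [extend_self] using extend_mem_criticalSet_iff hv le_rfl (x₁ := x)

theorem LandsIn.exists_mem_negSlice (hv : v o = 1) (h : v₁ ≤ v) (ho : v₁ o = v o)
    {x : Rep Q.double v} (hinv : LandsIn v₁ x) (hμ : complexMomentMap x = 0) (hx : Costable o x)
    (hcrit : IsCritical (canonicalParam o v) (extend (restrict h x) : Rep Q.double v)) :
    ∃ δ ∈ negSlice o (extend (restrict h x)),
      toOrbit (extend (restrict h x) + δ) = toOrbit x := by
  obtain ⟨c, hc, hd⟩ := (hinv.costable_restrict h hx).exists_defect_extend_eq hv h ho hcrit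
  obtain ⟨g, δ, hg, hsandwich, hδ⟩ := hinv.exists_gauge_orthogonal h
  refine ⟨δ, ⟨?_, hδ, ?_⟩, hg ▸ toOrbit_act g x⟩
  · exact hsandwich ▸ sandwich_mem_negSpace h hc hd hδ
  · exact hg ▸ complexMomentMap_act hμ g

theorem LandsIn.mem_flowModuli (hv : v o = 1) (h : v₁ ≤ v) (ho : v₁ o = v o) {x : Rep Q.double v}
    (hinv : LandsIn v₁ x) (hx : toOrbit x ∈ quiverVariety Q o v) :
    (toOrbit (restrict h x), toOrbit x) ∈ flowModuli Q o v₁ v := by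
  have hv₁ := ho.trans hv
  obtain ⟨hμ, hst⟩ := (toOrbit_mem_quiverVariety_iff hv).1 hx
  have hμ₁ := hinv.complexMomentMap_restrict h hμ
  have hst₁ := hinv.costable_restrict h hst
  obtain ⟨g₁, hg₁⟩ := hst₁.exists_isCritical_extend hv h ho
  obtain ⟨g₂, hg₂⟩ := hst.exists_isCritical_extend hv le_rfl rfl
  have hy := restrict_act_extendGauge h g₁ x
  obtain ⟨δ, hδ, horbit⟩ := (hinv.act_extendGauge h g₁).exists_mem_negSlice hv h ho
    (complexMomentMap_act hμ _) (hst.gauge _) (hy ▸ hg₁)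
  rw [hy] at hδ horbit
  refine ⟨(toOrbit_mem_quiverVariety_iff hv₁).2 ⟨hμ₁, hst₁⟩, hx, act g₁ (restrict h x), act g₂ x,
    toOrbit_act _ _, toOrbit_act _ _, ⟨?_, ?_, δ, hδ, ?_⟩⟩
  · exact (extend_mem_criticalSet_iff hv₁ h).2
      ⟨complexMomentMap_extend h (complexMomentMap_act hμ₁ g₁), hg₁, hst₁.gauge g₁⟩
  · exact (mem_criticalSet_self_iff hv).2
      ⟨complexMomentMap_act hμ g₂, by rwa [extend_self] at hg₂, hst.gauge g₂⟩
  · rw [horbit, toOrbit_act, toOrbit_act]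

theorem exists_landsIn_of_mem_flowModuli (hv : v o = 1) (h : v₁ ≤ v) (ho : v₁ o = v o)
    {c₁ : Orbits Q.double v₁} {c : Orbits Q.double v} (hc : (c₁, c) ∈ flowModuli Q o v₁ v) :
    ∃ x : Rep Q.double v, toOrbit x = c ∧ LandsIn v₁ x ∧ toOrbit (restrict h x) = c₁ := by
  obtain ⟨-, -, x₁, x₂, hx₁, hx₂, hcrit, -, δ, ⟨hneg, horth, -⟩, hδ⟩ := hc
  obtain ⟨-, hcrit, hst⟩ := (extend_mem_criticalSet_iff (ho.trans hv) h).1 hcrit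
  obtain ⟨c, hc, hd⟩ := hst.exists_defect_extend_eq hv h ho hcrit
  have hsandwich := sandwich_eq_self_of_mem_negSpace h hc hd horth hneg
  exact ⟨extend x₁ + δ, hδ.trans hx₂, landsIn_extend_add h x₁ hsandwich,
    (congrArg toOrbit (restrict_extend_add h x₁ hsandwich)).trans hx₁⟩

theorem mem_flowModuli_iff (hv : v o = 1) (h : v₁ ≤ v) (ho : v₁ o = v o)
    {c₁ : Orbits Q.double v₁} {c : Orbits Q.double v} :
    (c₁, c) ∈ flowModuli Q o v₁ v ↔ c ∈ quiverVariety Q o v ∧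
      ∃ x : Rep Q.double v, toOrbit x = c ∧ LandsIn v₁ x ∧ toOrbit (restrict h x) = c₁ := by
  refine ⟨fun hc => ⟨hc.2.1, exists_landsIn_of_mem_flowModuli hv h ho hc⟩, ?_⟩
  rintro ⟨hx, x, rfl, hinv, rfl⟩
  exact hinv.mem_flowModuli hv h ho hx

end FlowLines

section ImageAt

variable {I : Type u} {E : Type w} {Q : Quiv I E} {v : I → ℕ}

theorem imageAt_le_iff {k : I} {x : Rep Q v} {U : Submodule ℂ (Fin (v k) → ℂ)} :
    imageAt k x ≤ U ↔ ∀ a (h : Q.head a = k) (w : Fin (v (Q.tail a)) → ℂ),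
      (fun p => (x a *ᵥ w) (Fin.cast (congrArg v h.symm) p)) ∈ U := by
  simp only [imageAt, iSup_le_iff, Submodule.map_le_iff_le_comap]
  refine forall₂_congr fun a h => ⟨fun hU w => hU ⟨w, rfl⟩, ?_⟩
  rintro hU _ ⟨w, rfl⟩
  exact hU w

theorem mulVec_mem_imageAt (x : Rep Q v) (a : E) (w : Fin (v (Q.tail a)) → ℂ) :
    x a *ᵥ w ∈ imageAt (Q.head a) x :=
  imageAt_le_iff.1 le_rfl a rfl w

theorem map_imageAt_le (k : I) (g : Gauge v) (x : Rep Q v) :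
    (imageAt k x).map (g k : Matrix (Fin (v k)) (Fin (v k)) ℂ).mulVecLin ≤ imageAt k (act g x) := by
  rw [Submodule.map_le_iff_le_comap, imageAt_le_iff]
  rintro a rfl w
  have hmem := mulVec_mem_imageAt (act g x) a
    ((g (Q.tail a) : Matrix (Fin (v (Q.tail a))) (Fin (v (Q.tail a))) ℂ) *ᵥ w)
  simpa [act, Matrix.mulVec_mulVec, Matrix.mul_assoc, ← Units.val_mul] using hmem

theorem imageAt_act (k : I) (g : Gauge v) (x : Rep Q v) :
    imageAt k (act g x) =
      (imageAt k x).map (g k : Matrix (Fin (v k)) (Fin (v k)) ℂ).mulVecLin := by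
  refine le_antisymm (fun y hy => ?_) (map_imageAt_le k g x)
  have hmem := map_imageAt_le k g⁻¹ (act g x) ⟨y, hy, rfl⟩
  rw [← act_mul, inv_mul_cancel, act_one] at hmem
  exact ⟨_, hmem, by simp [Matrix.mulVec_mulVec]⟩

theorem finrank_map_unit {n : ℕ} (g : GL (Fin n) ℂ) (W : Submodule ℂ (Fin n → ℂ)) :
    Module.finrank ℂ (W.map (g : Matrix (Fin n) (Fin n) ℂ).mulVecLin) = Module.finrank ℂ W :=
  (Submodule.equivMapOfInjective _ (Matrix.mulVec_injective_of_isUnit g.isUnit) W).finrank_eq.symm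

theorem finrank_imageAt_act (k : I) (g : Gauge v) (x : Rep Q v) :
    Module.finrank ℂ (imageAt k (act g x)) = Module.finrank ℂ (imageAt k x) := by
  rw [imageAt_act, finrank_map_unit]

end ImageAt

section RangeInc

variable {I : Type u} {v₁ v : I → ℕ}

theorem mem_range_inc_iff (h : v₁ ≤ v) (i : I) (y : Fin (v i) → ℂ) :
    y ∈ LinearMap.range (inc v₁ v i).mulVecLin ↔ proj₂ v₁ v i *ᵥ y = 0 := by
  refine ⟨?_, fun hy => ⟨(inc v₁ v i)ᴴ *ᵥ y, ?_⟩⟩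
  · rintro ⟨w, rfl⟩
    rw [Matrix.mulVecLin_apply, Matrix.mulVec_mulVec, proj₂_mul_inc h, Matrix.zero_mulVec]
  · rw [Matrix.mulVecLin_apply, Matrix.mulVec_mulVec, ← proj₁, ← add_zero (proj₁ v₁ v i *ᵥ y),
      ← hy, ← Matrix.add_mulVec, proj₁_add_proj₂, Matrix.one_mulVec]

theorem inc_mulVec_apply (i : I) (w : Fin (v₁ i) → ℂ) (j : Fin (v i)) :
    (inc v₁ v i *ᵥ w) j = if hj : (j : ℕ) < v₁ i then w ⟨j, hj⟩ else 0 :=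
  inc_mul_apply i (Matrix.replicateCol Unit w) j ()

theorem mem_range_inc_iff_forall (h : v₁ ≤ v) (i : I) (y : Fin (v i) → ℂ) :
    y ∈ LinearMap.range (inc v₁ v i).mulVecLin ↔ ∀ j : Fin (v i), v₁ i ≤ (j : ℕ) → y j = 0 := by
  refine ⟨?_, fun hy => ⟨y ∘ Fin.castLE (h i), funext fun j => ?_⟩⟩
  · rintro ⟨w, rfl⟩ j hj
    exact (inc_mulVec_apply i w j).trans (dif_neg hj.not_gt)
  · rw [Matrix.mulVecLin_apply, inc_mulVec_apply]
    split_ifs with hj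
    · rfl
    · exact (hy j (not_lt.1 hj)).symm

theorem finrank_range_inc (h : v₁ ≤ v) (i : I) :
    Module.finrank ℂ (LinearMap.range (inc v₁ v i).mulVecLin) = v₁ i := by
  rw [LinearMap.finrank_range_of_inj (inc_mulVec_injective h i), Module.finrank_fin_fun]

variable {E : Type w} {Q : Quiv I E}

theorem landsIn_iff_imageAt_le (h : v₁ ≤ v) {x : Rep Q v} :
    LandsIn v₁ x ↔ ∀ i, imageAt i x ≤ LinearMap.range (inc v₁ v i).mulVecLin := by
  refine ⟨fun hx i => imageAt_le_iff.2 ?_, fun hx a => Matrix.ext_of_mulVec_single fun j => ?_⟩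
  · rintro a rfl w
    refine (mem_range_inc_iff h _ _).2 ?_
    change proj₂ v₁ v (Q.head a) *ᵥ (x a *ᵥ w) = 0
    rw [Matrix.mulVec_mulVec, hx, Matrix.zero_mulVec]
  · rw [← Matrix.mulVec_mulVec, Matrix.zero_mulVec]
    exact (mem_range_inc_iff h _ _).1 (hx _ (mulVec_mem_imageAt x a _))

end RangeInc

section Adapted

variable {I : Type u} [DecidableEq I] {E : Type w} {Q : Quiv I E} {v : I → ℕ} {k : I} {r : ℕ}

theorem lower_self (v : I → ℕ) (k : I) (r : ℕ) : lower v k r k = v k - r := by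
  simp [lower]

theorem lower_of_ne (v : I → ℕ) {k i : I} (h : i ≠ k) (r : ℕ) : lower v k r i = v i := by
  simp [lower, h]

theorem isAdapted_iff_imageAt_le {x : Rep Q.double v} :
    IsAdapted k r x ↔ imageAt k x ≤ LinearMap.range (inc (lower v k r) v k).mulVecLin := by
  refine forall₂_congr fun y _ => ?_
  rw [mem_range_inc_iff_forall (lower_le v k r), lower_self]

theorem isAdapted_iff_landsIn {x : Rep Q.double v} :
    IsAdapted k r x ↔ LandsIn (lower v k r) x := by
  rw [isAdapted_iff_imageAt_le, landsIn_iff_imageAt_le (lower_le v k r)]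
  refine ⟨fun hk i => ?_, fun h => h k⟩
  by_cases hi : i = k
  · exact hi ▸ hk
  · intro y _
    rw [mem_range_inc_iff (lower_le v k r), proj₂_eq_zero (lower_of_ne v hi r), Matrix.zero_mulVec]

theorem exists_gl_map_eq {n : ℕ} {W W' : Submodule ℂ (Fin n → ℂ)}
    (h : Module.finrank ℂ W = Module.finrank ℂ W') :
    ∃ g : GL (Fin n) ℂ, W.map (g : Matrix (Fin n) (Fin n) ℂ).mulVecLin = W' := by
  obtain ⟨e, he⟩ : ∃ e : (Fin n → ℂ) ≃ₗ[ℂ] (Fin n → ℂ), W.map e.toLinearMap = W' := by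
    obtain ⟨e, he⟩ := Submodule.exists_linearEquiv_restrict_eq (LinearEquiv.ofFinrankEq W W' h)
    refine ⟨e, Submodule.eq_of_le_of_finrank_eq ?_ ((e.finrank_map_eq W).trans h)⟩
    rintro _ ⟨w, hw, rfl⟩
    exact (he ⟨w, hw⟩).symm ▸ Subtype.property _
  refine ⟨⟨LinearMap.toMatrix' e.toLinearMap, LinearMap.toMatrix' e.symm.toLinearMap,
    by rw [← LinearMap.toMatrix'_comp]; simp, by rw [← LinearMap.toMatrix'_comp]; simp⟩, ?_⟩
  rw [← he]
  exact congrArg W.map (Matrix.toLin'_toMatrix' e.toLinearMap)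

omit [DecidableEq I] in
theorem exists_gauge_isAdapted {x : Rep Q.double v}
    (hx : Module.finrank ℂ (imageAt k x) + r = v k) : ∃ g : Gauge v, IsAdapted k r (act g x) := by
  classical
  obtain ⟨g, hg⟩ := exists_gl_map_eq (W := imageAt k x)
    (W' := LinearMap.range (inc (lower v k r) v k).mulVecLin)
    (by rw [finrank_range_inc (lower_le v k r), lower_self]; lia)
  refine ⟨Function.update 1 k g, ?_⟩
  rw [isAdapted_iff_imageAt_le, imageAt_act, Function.update_self, hg]

theorem IsAdapted.imageAt_eq {x : Rep Q.double v} (h : IsAdapted k r x)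
    (hx : Module.finrank ℂ (imageAt k x) + r = v k) :
    imageAt k x = LinearMap.range (inc (lower v k r) v k).mulVecLin := by
  refine Submodule.eq_of_le_of_finrank_eq (isAdapted_iff_imageAt_le.1 h) ?_
  rw [finrank_range_inc (lower_le v k r), lower_self]
  lia

theorem IsAdapted.proj₂_mul_gauge_mul_inc {x : Rep Q.double v} {g : Gauge v}
    (h : IsAdapted k r x) (hg : IsAdapted k r (act g x))
    (hx : Module.finrank ℂ (imageAt k x) + r = v k) (i : I) :
    proj₂ (lower v k r) v i *
      ((g i : Matrix (Fin (v i)) (Fin (v i)) ℂ) * inc (lower v k r) v i) = 0 := by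
  by_cases hi : i = k
  · subst hi
    refine Matrix.ext_of_mulVec_single fun j => ?_
    have hmem : inc (lower v i r) v i *ᵥ Pi.single j 1 ∈ imageAt i x := by
      rw [h.imageAt_eq hx]
      exact ⟨_, rfl⟩
    have himage := isAdapted_iff_imageAt_le.1 hg (map_imageAt_le i g x ⟨_, hmem, rfl⟩)
    rwa [mem_range_inc_iff (lower_le v i r), Matrix.mulVecLin_apply, Matrix.mulVec_mulVec,
      Matrix.mulVec_mulVec, Matrix.mul_assoc, ← Matrix.zero_mulVec (Pi.single j 1)] at himage
  · rw [proj₂_eq_zero (lower_of_ne v hi r), Matrix.zero_mul]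

theorem IsAdapted.toOrbit_restrict_eq {x y : Rep Q.double v} (hx : IsAdapted k r x)
    (hy : IsAdapted k r y) (hxy : toOrbit x = toOrbit y)
    (hrank : Module.finrank ℂ (imageAt k x) + r = v k) :
    toOrbit (restrict (lower_le v k r) x) = toOrbit (restrict (lower_le v k r) y) := by
  obtain ⟨g, rfl⟩ := toOrbit_eq_iff.1 hxy
  have hinv : act g⁻¹ (act g x) = x := by rw [← act_mul, inv_mul_cancel, act_one]
  refine toOrbit_eq_iff.2 ⟨_, (isAdapted_iff_landsIn.1 hx).act_compressGauge (lower_le v k r)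
    (hx.proj₂_mul_gauge_mul_inc hy hrank) ?_⟩
  exact hy.proj₂_mul_gauge_mul_inc (g := g⁻¹) (hinv.symm ▸ hx) (by rwa [finrank_imageAt_act])

theorem IsAdapted.nakajimaProj_eq {x : Rep Q.double v} (h : IsAdapted k r x)
    (hx : Module.finrank ℂ (imageAt k x) + r = v k) :
    nakajimaProj k r (toOrbit x) = toOrbit (restrict (lower_le v k r) x) := by
  have hex : ∃ y : Rep Q.double v, toOrbit y = toOrbit x ∧ IsAdapted k r y := ⟨x, rfl, h⟩
  rw [nakajimaProj, dif_pos hex]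
  exact (h.toOrbit_restrict_eq hex.choose_spec.2 hex.choose_spec.1.symm hx).symm

theorem imageAt_le_map_imageAt_restrict (hloop : ∀ a, Q.head a ≠ Q.tail a) {x : Rep Q v}
    (h : LandsIn (lower v k r) x) : imageAt k x ≤
      (imageAt k (restrict (lower_le v k r) x)).map (inc (lower v k r) v k).mulVecLin := by
  rw [imageAt_le_iff]
  rintro a rfl w
  have hproj : proj₁ (lower v (Q.head a) r) v (Q.tail a) = 1 := by
    rw [← proj₁_add_proj₂ (lower v (Q.head a) r) v (Q.tail a),
      proj₂_eq_zero (lower_of_ne v (hloop a).symm r), add_zero]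
  refine ⟨_, mulVec_mem_imageAt (restrict (lower_le v _ r) x) a
    ((inc (lower v (Q.head a) r) v (Q.tail a))ᴴ *ᵥ w), ?_⟩
  rw [Matrix.mulVecLin_apply, Matrix.mulVec_mulVec, Matrix.mulVec_mulVec,
    ← h.mul_inc (lower_le v _ r), Matrix.mul_assoc, ← proj₁, hproj, Matrix.mul_one]
  rfl

theorem IsAdapted.imageAt_restrict_eq_top (hloop : ∀ a, Q.head a ≠ Q.tail a)
    {x : Rep Q.double v} (h : IsAdapted k r x)
    (hx : Module.finrank ℂ (imageAt k x) + r = v k) :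
    imageAt k (restrict (lower_le v k r) x) = ⊤ := by
  have hloop' : ∀ a, Q.double.head a ≠ Q.double.tail a :=
    Sum.rec hloop fun a => (hloop a).symm
  refine eq_top_iff.2 fun y _ => ?_
  have hy : (inc (lower v k r) v k).mulVecLin y ∈ imageAt k x := h.imageAt_eq hx ▸ ⟨y, rfl⟩
  obtain ⟨z, hz, hzy⟩ := imageAt_le_map_imageAt_restrict hloop' (isAdapted_iff_landsIn.1 h) hy
  rwa [← inc_mulVec_injective (lower_le v k r) k hzy]

end Adapted

section Stratum

variable {I : Type u} [Fintype I] [DecidableEq I] {E : Type w} [Fintype E] {Q : Quiv I E}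
  {v : I → ℕ} {o k : I} {r : ℕ}

theorem toOrbit_mem_quiverStratum_iff {x : Rep Q.double v} :
    toOrbit x ∈ quiverStratum Q o v k r ↔
      toOrbit x ∈ quiverVariety Q o v ∧ Module.finrank ℂ (imageAt k x) + r = v k := by
  have hcodim : ∀ y : Rep Q.double v, Module.finrank ℂ ((Fin (v k) → ℂ) ⧸ imageAt k y) +
      Module.finrank ℂ (imageAt k y) = v k := fun y => by
    rw [Submodule.finrank_quotient_add_finrank, Module.finrank_fin_fun]
  refine and_congr_right fun _ => ⟨?_, fun h => ⟨x, rfl, ?_⟩⟩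
  · rintro ⟨y, hyx, rfl⟩
    obtain ⟨g, rfl⟩ := toOrbit_eq_iff.1 hyx
    rw [finrank_imageAt_act, add_comm, hcodim]
  · have := hcodim x
    lia

theorem exists_isAdapted {c : Orbits Q.double v} (hc : c ∈ quiverStratum Q o v k r) :
    ∃ x : Rep Q.double v, toOrbit x = c ∧ IsAdapted k r x := by
  obtain ⟨x, rfl⟩ : ∃ x : Rep Q.double v, toOrbit x = c := Quotient.exists_rep c
  obtain ⟨g, hg⟩ := exists_gauge_isAdapted (toOrbit_mem_quiverStratum_iff.1 hc).2
  exact ⟨act g x, toOrbit_act g x, hg⟩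

theorem nakajimaProj_eq_of_toOrbit_eq {c : Orbits Q.double v} (hc : c ∈ quiverStratum Q o v k r)
    {x : Rep Q.double v} (hx : toOrbit x = c) (h : IsAdapted k r x) :
    nakajimaProj k r c = toOrbit (restrict (lower_le v k r) x) := by
  subst hx
  exact h.nakajimaProj_eq (toOrbit_mem_quiverStratum_iff.1 hc).2

theorem nakajimaProj_mem_quiverStratum (hloop : ∀ a, Q.head a ≠ Q.tail a) (hv : v o = 1)
    (hk : k ≠ o) {c : Orbits Q.double v} (hc : c ∈ quiverStratum Q o v k r) :
    nakajimaProj k r c ∈ quiverStratum Q o (lower v k r) k 0 := by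
  obtain ⟨x, rfl, hx⟩ := exists_isAdapted hc
  obtain ⟨hvar, hrank⟩ := toOrbit_mem_quiverStratum_iff.1 hc
  obtain ⟨hμ, hst⟩ := (toOrbit_mem_quiverVariety_iff hv).1 hvar
  have hinv := isAdapted_iff_landsIn.1 hx
  rw [hx.nakajimaProj_eq hrank, toOrbit_mem_quiverStratum_iff,
    toOrbit_mem_quiverVariety_iff (by rw [lower_of_ne v hk.symm, hv])]
  refine ⟨⟨hinv.complexMomentMap_restrict _ hμ, hinv.costable_restrict _ hst⟩, ?_⟩
  rw [hx.imageAt_restrict_eq_top hloop hrank, finrank_top, Module.finrank_fin_fun, add_zero]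

theorem mem_flowModuli_iff_eq_nakajimaProj (hv : v o = 1) (hk : k ≠ o) {c : Orbits Q.double v}
    (hc : c ∈ quiverStratum Q o v k r) {c₀ : Orbits Q.double (lower v k r)} :
    (c₀, c) ∈ flowModuli Q o (lower v k r) v ↔ c₀ = nakajimaProj k r c := by
  rw [mem_flowModuli_iff hv (lower_le v k r) (lower_of_ne v hk.symm r)]
  constructor
  · rintro ⟨-, x, hxc, hx, rfl⟩
    exact (nakajimaProj_eq_of_toOrbit_eq hc hxc (isAdapted_iff_landsIn.2 hx)).symm
  · rintro rfl
    obtain ⟨x, hxc, hx⟩ := exists_isAdapted hc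
    exact ⟨hc.1, x, hxc, isAdapted_iff_landsIn.1 hx, (nakajimaProj_eq_of_toOrbit_eq hc hxc hx).symm⟩

end Stratum

section OrbitSpace

variable {I : Type u} {E : Type w} {Q : Quiv I E} {v : I → ℕ}

theorem continuous_act (g : Gauge v) : Continuous fun x : Rep Q v => act g x := by
  unfold act
  fun_prop

theorem continuous_restrict {v₁ : I → ℕ} (h : v₁ ≤ v) :
    Continuous fun x : Rep Q v => restrict h x := by
  unfold restrict
  fun_prop

theorem continuous_toOrbit : Continuous (toOrbit : Rep Q v → Orbits Q v) :=
  continuous_quotient_mk'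

theorem isOpenMap_toOrbit : IsOpenMap (toOrbit : Rep Q v → Orbits Q v) := by
  intro U hU
  have hsat : (toOrbit : Rep Q v → Orbits Q v) ⁻¹' (toOrbit '' U) =
      ⋃ g : Gauge v, (fun x => act g x) ⁻¹' U := by
    ext x
    simp only [Set.mem_preimage, Set.mem_image, Set.mem_iUnion]
    constructor
    · rintro ⟨y, hy, hyx⟩
      obtain ⟨g, rfl⟩ := toOrbit_eq_iff.1 hyx.symm
      exact ⟨g, hy⟩
    · rintro ⟨g, hg⟩
      exact ⟨_, hg, toOrbit_act g x⟩
  rw [← isQuotientMap_quotient_mk'.isOpen_preimage]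
  exact hsat ▸ isOpen_iUnion fun g => hU.preimage (continuous_act g)

/-- The representation `M⁻¹ x M`, for a family `M` of matrices that need not be invertible; it is
used to act by families of matrices that depend continuously on a parameter. -/
def conjugate (M : GaugeLie v) (x : Rep Q v) : Rep Q v :=
  fun a => (M (Q.head a))⁻¹ * x a * M (Q.tail a)

theorem conjugate_one (x : Rep Q v) : conjugate 1 x = x := by
  funext a
  simp [conjugate]

theorem conjugate_coe (g : Gauge v) (x : Rep Q v) : conjugate (fun i => g i) x = act g⁻¹ x := by
  funext a
  simp [conjugate, act]

theorem continuousAt_matrix_mul {X l m n : Type*} [TopologicalSpace X] [Fintype m]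
    {A : X → Matrix l m ℂ} {B : X → Matrix m n ℂ} {t : X} (hA : ContinuousAt A t)
    (hB : ContinuousAt B t) : ContinuousAt (fun s => A s * B s) t :=
  (continuous_fst.matrix_mul continuous_snd).continuousAt.comp (hA.prodMk hB)

theorem continuousAt_conjugate {X : Type*} [TopologicalSpace X] {t : X} {M : X → GaugeLie v}
    {x : X → Rep Q v} (hM : ContinuousAt M t) (hx : ContinuousAt x t)
    (hdet : ∀ i, (M t i).det ≠ 0) : ContinuousAt (fun s => conjugate (M s) (x s)) t := by
  have hMi (i : I) : ContinuousAt (fun s => M s i) t := continuousAt_pi.1 hM i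
  have hinv (i : I) : ContinuousAt (fun s => (M s i)⁻¹) t :=
    (continuousAt_inv_of_det_ne_zero (hdet i)).comp (hMi i)
  exact continuousAt_pi.2 fun a => continuousAt_matrix_mul
    (continuousAt_matrix_mul (hinv _) (continuousAt_pi.1 hx a)) (hMi _)

end OrbitSpace

section Frame

variable {I : Type u} {E : Type w} {Q : Quiv I E} {v : I → ℕ} {k : I}

theorem exists_continuous_mem_imageAt {x₀ : Rep Q v} {y : Fin (v k) → ℂ} (hy : y ∈ imageAt k x₀) :
    ∃ f : Rep Q v → Fin (v k) → ℂ, Continuous f ∧ (∀ x, f x ∈ imageAt k x) ∧ f x₀ = y := by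
  let S : Submodule ℂ (Rep Q v → Fin (v k) → ℂ) :=
    continuousSubmodule (Rep Q v) ℂ (Fin (v k) → ℂ) ⊓ Submodule.pi Set.univ fun x => imageAt k x
  have hS : imageAt k x₀ ≤ S.map (LinearMap.proj x₀) := by
    rw [imageAt_le_iff]
    rintro a rfl w
    have hcont : Continuous fun x : Rep Q v => x a *ᵥ w := by fun_prop
    exact ⟨fun x => x a *ᵥ w, ⟨hcont, fun x _ => mulVec_mem_imageAt x a w⟩, rfl⟩
  obtain ⟨f, ⟨hf, hmem⟩, hfy⟩ := hS hy
  exact ⟨f, hf, fun x => hmem x trivial, hfy⟩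

theorem exists_continuous_matrix_mem_imageAt {n : ℕ} {x₀ : Rep Q v}
    {A : Matrix (Fin (v k)) (Fin n) ℂ} (hA : ∀ z, A *ᵥ z ∈ imageAt k x₀) :
    ∃ F : Rep Q v → Matrix (Fin (v k)) (Fin n) ℂ,
      Continuous F ∧ (∀ x z, F x *ᵥ z ∈ imageAt k x) ∧ F x₀ = A := by
  choose f hf hmem hf₀ using fun j => exists_continuous_mem_imageAt (hA (Pi.single j 1))
  refine ⟨fun x => Matrix.of fun p j => f j x p, ?_, fun x z => ?_, ?_⟩
  · exact continuous_pi fun p => continuous_pi fun j => (continuous_apply p).comp (hf j)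
  · simp only [Matrix.mulVec_eq_sum, op_smul_eq_smul]
    exact Submodule.sum_mem _ fun j _ => Submodule.smul_mem _ (z j) (hmem j x)
  · ext p j
    simp [hf₀]

variable [DecidableEq I] {r : ℕ}

theorem exists_continuous_frame {x₀ : Rep Q.double v} (h : IsAdapted k r x₀)
    (hx₀ : Module.finrank ℂ (imageAt k x₀) + r = v k) :
    ∃ m : Rep Q.double v → Matrix (Fin (v k)) (Fin (v k)) ℂ, Continuous m ∧ m x₀ = 1 ∧
      ∀ x, (LinearMap.range (inc (lower v k r) v k).mulVecLin).map (m x).mulVecLin ≤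
        imageAt k x := by
  obtain ⟨F, hF, hmem, hF₀⟩ := exists_continuous_matrix_mem_imageAt (x₀ := x₀)
    (A := inc (lower v k r) v k) fun z => h.imageAt_eq hx₀ ▸ ⟨z, rfl⟩
  refine ⟨fun x => F x * (inc (lower v k r) v k)ᴴ + proj₂ (lower v k r) v k, by fun_prop, ?_, ?_⟩
  · simp only [hF₀]
    exact proj₁_add_proj₂ (lower v k r) v k
  · rintro x _ ⟨_, ⟨z, rfl⟩, rfl⟩
    have hmul : (F x * (inc (lower v k r) v k)ᴴ + proj₂ (lower v k r) v k) *
        inc (lower v k r) v k = F x := by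
      rw [Matrix.add_mul, Matrix.mul_assoc, conjTranspose_inc_mul_inc (lower_le v k r),
        proj₂_mul_inc (lower_le v k r), Matrix.mul_one, add_zero]
    rw [Matrix.mulVecLin_apply, Matrix.mulVecLin_apply, Matrix.mulVec_mulVec, hmul]
    exact hmem x z

theorem isAdapted_act_inv_of_map_le {x : Rep Q.double v}
    (hx : Module.finrank ℂ (imageAt k x) + r = v k) {g : Gauge v}
    (hg : (LinearMap.range (inc (lower v k r) v k).mulVecLin).map
      (g k : Matrix (Fin (v k)) (Fin (v k)) ℂ).mulVecLin ≤ imageAt k x) :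
    IsAdapted k r (act g⁻¹ x) := by
  have heq := Submodule.eq_of_le_of_finrank_eq hg (by
    rw [finrank_map_unit, finrank_range_inc (lower_le v k r), lower_self]
    lia)
  rw [isAdapted_iff_imageAt_le, imageAt_act, ← heq]
  rintro _ ⟨_, ⟨z, hz, rfl⟩, rfl⟩
  simpa [Matrix.mulVec_mulVec, ← Units.val_mul] using hz

omit [DecidableEq I] in
theorem exists_continuousAt_isAdapted {x₀ : Rep Q.double v} (h : IsAdapted k r x₀)
    (hx₀ : Module.finrank ℂ (imageAt k x₀) + r = v k) :
    ∃ R : Rep Q.double v → Rep Q.double v, ContinuousAt R x₀ ∧ R x₀ = x₀ ∧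
      ∀ᶠ x in nhds x₀, Module.finrank ℂ (imageAt k x) + r = v k →
        toOrbit (R x) = toOrbit x ∧ IsAdapted k r (R x) := by
  classical
  obtain ⟨m, hm, hm₀, hmem⟩ := exists_continuous_frame h hx₀
  let M : Rep Q.double v → GaugeLie v := fun x => Function.update 1 k (m x)
  have hM₀ : M x₀ = 1 := by
    simp only [M, hm₀]
    exact Function.update_eq_self k (1 : GaugeLie v)
  refine ⟨fun x => conjugate (M x) x, ?_, by simp only [hM₀, conjugate_one], ?_⟩
  · exact continuousAt_conjugate (continuous_const.update k hm).continuousAt continuousAt_id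
      (by simp [hM₀])
  have hdet₀ : (m x₀).det ≠ 0 := by simp [hm₀]
  filter_upwards [hm.matrix_det.continuousAt.eventually_ne hdet₀] with x hdet hx
  let g : Gauge v := Function.update 1 k (Matrix.GeneralLinearGroup.mkOfDetNeZero (m x) hdet)
  have hg : M x = fun i => (g i : Matrix (Fin (v i)) (Fin (v i)) ℂ) := by
    funext i
    by_cases hi : i = k
    · subst hi
      simp [M, g, Matrix.GeneralLinearGroup.mkOfDetNeZero]
    · simp [M, g, hi]
  simp only [hg, conjugate_coe]
  refine ⟨toOrbit_act _ _, isAdapted_act_inv_of_map_le hx ?_⟩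
  rw [← congrFun hg k]
  simpa [M] using hmem x

end Frame

section Homeomorph

variable {I : Type u} [Fintype I] [DecidableEq I] {E : Type w} [Fintype E] {Q : Quiv I E}
  {v : I → ℕ} {o k : I} {r : ℕ}

theorem continuousOn_nakajimaProj :
    ContinuousOn (nakajimaProj (Q := Q) (v := v) k r) (quiverStratum Q o v k r) := by
  intro c hc
  obtain ⟨x₀, rfl, h₀⟩ := exists_isAdapted hc
  have hrank := (toOrbit_mem_quiverStratum_iff.1 hc).2
  obtain ⟨R, hR, hR₀, hadapted⟩ := exists_continuousAt_isAdapted h₀ hrank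
  have hcont : ContinuousAt (fun x => toOrbit (restrict (lower_le v k r) (R x))) x₀ :=
    (continuous_toOrbit.comp (continuous_restrict _)).continuousAt.comp hR
  intro V hV
  rw [h₀.nakajimaProj_eq hrank] at hV
  have hU := isOpenMap_toOrbit.image_mem_nhds
    (Filter.inter_mem (hcont (hR₀.symm ▸ hV)) hadapted)
  rw [Filter.mem_map]
  filter_upwards [mem_nhdsWithin_of_mem_nhds hU, self_mem_nhdsWithin] with c' hc' hcS
  obtain ⟨x, ⟨hxV, hx⟩, rfl⟩ := hc'
  obtain ⟨horbit, hRx⟩ := hx (toOrbit_mem_quiverStratum_iff.1 hcS).2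
  rwa [Set.mem_preimage, nakajimaProj_eq_of_toOrbit_eq hcS horbit hRx]

/-- The second projection of the restricted flow space, as a homeomorphism onto `𝓜_{k;r}(Q, v)`;
its inverse is `c ↦ (p(c), c)`. -/
def flowHomeomorph (hloop : ∀ a, Q.head a ≠ Q.tail a) (hv : v o = 1) (hk : k ≠ o) :
    restrictedFlow Q o v k r ≃ₜ quiverStratum Q o v k r where
  toFun z := ⟨z.1.2, z.2.1.2⟩
  invFun c := ⟨(nakajimaProj k r c.1, c.1), ⟨nakajimaProj_mem_quiverStratum hloop hv hk c.2, c.2⟩,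
    (mem_flowModuli_iff_eq_nakajimaProj hv hk c.2).2 rfl⟩
  left_inv z := Subtype.ext <| Prod.ext
    ((mem_flowModuli_iff_eq_nakajimaProj hv hk z.2.1.2).1 z.2.2).symm rfl
  right_inv _ := rfl
  continuous_toFun := (continuous_snd.comp continuous_subtype_val).subtype_mk _
  continuous_invFun :=
    ((continuousOn_iff_continuous_domRestrict.1 continuousOn_nakajimaProj).prodMk
      continuous_subtype_val).subtype_mk _

end Homeomorph

end NakajimaFlow

end

open NakajimaFlow in
theorem proposition4p12 {I : Type*} {E : Type*} [Fintype I] [DecidableEq I] [Fintype E]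
    (Q : NakajimaFlow.Quiv I E) (hloop : ∀ a : E, Q.head a ≠ Q.tail a)
    (o : I) (v : I → ℕ) (hv : v o = 1) (k : I) (hk : k ≠ o) (r : ℕ) :
    -- Nakajima's projection `p` is defined on `𝓜_{k;r}(Q, v)`, independently of the
    -- representative, and has values in `𝓜_{k;0}(Q, v - r e_k)`
    (∀ c ∈ NakajimaFlow.quiverStratum Q o v k r,
      (∃ x, NakajimaFlow.toOrbit x = c ∧ NakajimaFlow.IsAdapted k r x) ∧
      (∀ x, NakajimaFlow.toOrbit x = c → NakajimaFlow.IsAdapted k r x →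
        NakajimaFlow.nakajimaProj k r c =
          NakajimaFlow.toOrbit (NakajimaFlow.restrict (NakajimaFlow.lower_le v k r) x)) ∧
      NakajimaFlow.nakajimaProj k r c ∈
        NakajimaFlow.quiverStratum Q o (NakajimaFlow.lower v k r) k 0) ∧
    -- existence and uniqueness of `[x₀]`, and `[x₀] = p([x])`
    (∀ c ∈ NakajimaFlow.quiverStratum Q o v k r,
      (∃! c₀, c₀ ∈ NakajimaFlow.quiverStratum Q o (NakajimaFlow.lower v k r) k 0 ∧
        (c₀, c) ∈ NakajimaFlow.flowModuli Q o (NakajimaFlow.lower v k r) v) ∧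
      ∀ c₀ ∈ NakajimaFlow.quiverStratum Q o (NakajimaFlow.lower v k r) k 0,
        (c₀, c) ∈ NakajimaFlow.flowModuli Q o (NakajimaFlow.lower v k r) v →
          c₀ = NakajimaFlow.nakajimaProj k r c) ∧
    -- the restricted flow space is, through its second projection, homeomorphic to
    -- `𝓜_{k;r}(Q, v)`, and its first projection then becomes `p`
    (∃ e : NakajimaFlow.restrictedFlow Q o v k r ≃ₜ NakajimaFlow.quiverStratum Q o v k r,
      ∀ z : NakajimaFlow.restrictedFlow Q o v k r,
        (e z : NakajimaFlow.Orbits Q.double v) = z.1.2 ∧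
        z.1.1 = NakajimaFlow.nakajimaProj k r (e z : NakajimaFlow.Orbits Q.double v)) := by
  refine ⟨fun c hc => ⟨exists_isAdapted hc, fun x => nakajimaProj_eq_of_toOrbit_eq hc,
    nakajimaProj_mem_quiverStratum hloop hv hk hc⟩, fun c hc => ⟨?_, fun c₀ _ hflow =>
      (mem_flowModuli_iff_eq_nakajimaProj hv hk hc).1 hflow⟩,
    flowHomeomorph hloop hv hk, fun z => ⟨rfl, ?_⟩⟩
  · refine ⟨nakajimaProj k r c, ⟨nakajimaProj_mem_quiverStratum hloop hv hk hc,
      (mem_flowModuli_iff_eq_nakajimaProj hv hk hc).2 rfl⟩, fun c₀ hc₀ => ?_⟩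
    exact (mem_flowModuli_iff_eq_nakajimaProj hv hk hc).1 hc₀.2
  · exact (mem_flowModuli_iff_eq_nakajimaProj hv hk z.2.1.2).1 z.2.2
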